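/- Let $\mathcal C$ be a category with a Grothendieck topology given by covering families $\{U_i\to X\}$: isomorphisms are covers, for every cover $\{U_i\to X\}$ and every $Y\to X$ the fiber products $U_i\times_X Y$ exist and the projections $\{U_i\times_X Y\to Y\}$ form a cover, and composites of covers are covers. A functor $p:\mathcal E\to\mathcal C$ is a *category fibered in groupoids* if (i) for $f:Y\to X$ in $\mathcal C$ and $X'\in\mathcal E$ with $p(X')=X$ there is $f':Y'\to X'$ with $p(f')=f$; and (ii) for $f':Y'\to X'$, $g':Z'\to X'$ in $\mathcal E$ and $h:p(Y')\to p(Z')$ with $p(g')\circ h=p(f')$ there is a unique $h':Y'\to Z'$ with $g'\circ h'=f'$ and $p(h')=h$. Write $\mathcal E_X$ for the fiber groupoid over $X$ (objects over $X$, morphisms over $\mathrm{id}_X$), $a\mapsto a|_Y$ for chosen pullback functors $\mathcal E_X\to\mathcal E_Y$, and $U_{i_0\cdots i_n}=U_{i_0}\times_X\cdots\times_X U_{i_n}$. Canonical isomorphisms $(a|_Y)|_Z\cong a|_Z$ are suppressed. The category fibered in groupoids $\mathcal E$ is a *stack* if for every cover $\{U_i\to X\}$: 1. for all $a,b\in\mathcal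 E_X$ the diagram $\mathrm{Hom}_{\mathcal E_X}(a,b)\to\prod_i\mathrm{Hom}_{\mathcal E_{U_i}}(a|_{U_i},b|_{U_i})\rightrightarrows\prod_{i,j}\mathrm{Hom}_{\mathcal E_{U_{ij}}}(a|_{U_{ij}},b|_{U_{ij}})$ is an equalizer; 2. given $a_i\in\mathcal E_{U_i}$ and isomorphisms $\alpha_{ij}:a_i|_{U_{ij}}\to a_j|_{U_{ij}}$ with $\alpha_{jk}|_{U_{ijk}}\circ\alpha_{ij}|_{U_{ijk}}=\alpha_{ik}|_{U_{ijk}}$ for all $i,j,k$, there are $a\in\mathcal E_X$ and isomorphisms $\beta_i:a|_{U_i}\to a_i$ with $\alpha_{ij}\circ\beta_i|_{U_{ij}}=\beta_j|_{U_{ij}}$ for all $i,j$. For $X\in\mathcal C$ let $\mathcal E(X)$ be the groupoid of functors $\mathcal C/X\to\mathcal E$ over $\mathcal C$, with natural isomorphisms over $\mathrm{id}_{\mathcal C}$ as morphisms; it is contravariantly functorial in $X$ by composition. For a small category $I$ and a diagram $G:I\to\mathrm{Grpd}$ of groupoids, the homotopy limit $\operatorname{holim}G$ is the equalizer in $\mathrm{Grpd}$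 of the two natural maps $$\prod_{i}G(i)^{N(I/i)}\rightrightarrows\prod_{j\to i}G(i)^{N(I/j)},$$ where, for a category $D$, $G(i)^{N(D)}$ is the groupoid of functors to $G(i)$ from the fundamental groupoid of the nerve $N(D)$, i.e. from the free groupoid on $D$. A strict cone over $G$ with vertex $H$ induces a canonical functor $H\to\operatorname{holim}G$ through constant functors. **Theorem.** A category fibered in groupoids $\mathcal E\to\mathcal C$ is a stack if and only if for every cover $\{U_i\to X\}$ in $\mathcal C$ the canonical functor, induced by restriction along the maps $U_{i_0\cdots i_n}\to X$, $$\mathcal E(X)\longrightarrow\operatorname{holim}\Bigl(\prod_i\mathcal E(U_i)\rightrightarrows\prod_{i,j}\mathcal E(U_{ij})\ \substack{\to\\[-0.6ex]\to\\[-0.6ex]\to}\ \prod_{i,j,k}\mathcal E(U_{ijk})\cdots\Bigr)$$ is an equivalence of categories, where the homotopy limit is taken over the full cosimplicial groupoid $[n]\mapsto\prod_{i_0,\dots,i_n}\mathcal E(U_{i_0\cdots i_n})$. -/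

import Mathlib

open CategoryTheory CategoryTheory.Limits CategoryTheory.Functor

universe w v u v₁ u₁ v₂ u₂

noncomputable section

namespace HomotopySheaf

/-! ### Categories fibered in groupoids -/

section Fibered

variable {C : Type u} [Category.{v} C] {E : Type u₂} [Category.{v₂} E]

/-- `p : E ⥤ C` is a category fibered in groupoids: morphisms of the base lift along any
prescribed target, and every factorization in the base of (the image of) one morphism of `E`
through (the image of) another one lifts uniquely to `E`. -/
class IsFiberedInGroupoids (p : E ⥤ C) : Prop where
  exists_lift {X' : E} {Y : C} (f : Y ⟶ p.obj X') :
    ∃ (Y' : E) (f' : Y' ⟶ X'), p.IsHomLift f f'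
  existsUnique_lift {X' Y' Z' : E} (f' : Y' ⟶ X') (g' : Z' ⟶ X')
    (h : p.obj Y' ⟶ p.obj Z') (w : h ≫ p.map g' = p.map f') :
    ∃! h' : Y' ⟶ Z', p.map h' = h ∧ h' ≫ g' = f'

variable (p : E ⥤ C) [IsFiberedInGroupoids p]

theorem isStronglyCartesian {X Y : C} {a b : E} (f : Y ⟶ X) (φ : b ⟶ a) [p.IsHomLift f φ] :
    p.IsStronglyCartesian f φ where
  universal_property' {c} g φ' hφ' := by
    subst_hom_lift p f φ
    have h1 : g ≫ p.map φ = p.map φ' := IsHomLift.eq_of_isHomLift p _ _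
    obtain ⟨h', ⟨e1, e2⟩, huniq⟩ :=
      IsFiberedInGroupoids.existsUnique_lift (p := p) φ' φ g h1
    refine ⟨h', ⟨?_, e2⟩, ?_⟩
    · subst e1; infer_instance
    · rintro χ ⟨hχ, hχ'⟩
      exact huniq χ ⟨(IsHomLift.eq_of_isHomLift p g χ).symm, hχ'⟩

instance isFibered : p.IsFibered :=
  IsFibered.of_exists_isStronglyCartesian fun _ _ f => by
    obtain ⟨b, φ, h⟩ := IsFiberedInGroupoids.exists_lift (p := p) f
    exact ⟨b, φ, isStronglyCartesian p f φ⟩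

/-- Morphisms over an identity are isomorphisms. -/
theorem isIso_of_isHomLift_id {X : C} {a b : E} (φ : a ⟶ b) [p.IsHomLift (𝟙 X) φ] : IsIso φ :=
  have := isStronglyCartesian p (𝟙 X) φ
  IsStronglyCartesian.isIso_of_base_isIso p (𝟙 X) φ

/-- The fiber categories are groupoids. -/
instance fiber_isIso {X : C} {a b : p.Fiber X} (φ : a ⟶ b) : IsIso φ := by
  have := φ.2
  have := isIso_of_isHomLift_id p (X := X) φ.1
  refine ⟨⟨⟨inv φ.1, inferInstance⟩, ?_, ?_⟩⟩
  · exact Subtype.ext (IsIso.hom_inv_id φ.1)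
  · exact Subtype.ext (IsIso.inv_hom_id φ.1)

variable {p} in
/-- The chosen pullback `f^* a` of an object `a` of the fiber over `X` along `f : Y ⟶ X`. -/
def pullObj {X Y : C} (f : Y ⟶ X) (a : p.Fiber X) : p.Fiber Y :=
  ⟨IsPreFibered.pullbackObj a.2 f, IsPreFibered.pullbackObj_proj a.2 f⟩

variable {p} in
/-- The chosen morphism `f^* a ⟶ a` lying over `f`. -/
def pullProj {X Y : C} (f : Y ⟶ X) (a : p.Fiber X) : (pullObj f a).1 ⟶ a.1 :=
  IsPreFibered.pullbackMap a.2 f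

instance pullProj_isCartesian {X Y : C} (f : Y ⟶ X) (a : p.Fiber X) :
    p.IsCartesian f (pullProj f a) :=
  IsPreFibered.pullbackMap.IsCartesian a.2 f

variable {p} in
/-- The unique morphism `b ⟶ f^* a` over the identity through which a morphism `b ⟶ a`
over `f` factors. -/
def pullLift {X Y : C} (f : Y ⟶ X) (a : p.Fiber X) (b : p.Fiber Y) (φ : b.1 ⟶ a.1)
    [p.IsHomLift f φ] : b ⟶ pullObj f a :=
  ⟨IsCartesian.map p f (pullProj f a) φ, inferInstance⟩

theorem pullLift_proj {X Y : C} (f : Y ⟶ X) (a : p.Fiber X) (b : p.Fiber Y) (φ : b.1 ⟶ a.1)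
    [p.IsHomLift f φ] : (pullLift f a b φ).1 ≫ pullProj f a = φ :=
  IsCartesian.fac p f (pullProj f a) φ

theorem pull_hom_ext {X Y : C} (f : Y ⟶ X) {a : p.Fiber X} {b : p.Fiber Y}
    (φ ψ : b ⟶ pullObj f a) (h : φ.1 ≫ pullProj f a = ψ.1 ≫ pullProj f a) : φ = ψ := by
  have := φ.2
  have := ψ.2
  exact Subtype.ext (IsCartesian.ext p f (pullProj f a) φ.1 ψ.1 h)

/-- The chosen pullback functor `f^*` between the fibers. -/
def pull {X Y : C} (f : Y ⟶ X) : p.Fiber X ⥤ p.Fiber Y where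
  obj a := pullObj f a
  map {a b} φ :=
    have := φ.2
    pullLift f b (pullObj f a) (pullProj f a ≫ φ.1)
  map_id a := by
    apply pull_hom_ext
    erw [pullLift_proj]
    exact (Category.comp_id _).trans (Category.id_comp _).symm
  map_comp {a b c} φ ψ := by
    have := φ.2
    have := ψ.2
    have h1 := pullLift_proj p f b (pullObj f a) (pullProj f a ≫ φ.1)
    have h2 := pullLift_proj p f c (pullObj f b) (pullProj f b ≫ ψ.1)
    apply pull_hom_ext
    erw [pullLift_proj]
    change pullProj f a ≫ φ.1 ≫ ψ.1 = (_ ≫ _) ≫ _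
    rw [Category.assoc]
    erw [h2]
    rw [← Category.assoc, ← Category.assoc]
    erw [h1]

/-- The canonical isomorphism `g^* (f^* a) ≅ h^* a`, where `h` is the composite of `g` and `f`;
it is the unique one over the identity which is compatible with the projections to `a`. -/
def pullComp {X Y Z : C} (g : Z ⟶ Y) (f : Y ⟶ X) (h : Z ⟶ X) (w : g ≫ f = h)
    (a : p.Fiber X) : (pull p g).obj ((pull p f).obj a) ≅ (pull p h).obj a :=
  have : p.IsHomLift h (pullProj g (pullObj f a) ≫ pullProj f a) := by
    subst w; infer_instance
  show pullObj g (pullObj f a) ≅ pullObj h a from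
    asIso (pullLift h a (pullObj g (pullObj f a)) (pullProj g (pullObj f a) ≫ pullProj f a))

/-- The restriction along `g : W ⟶ V` of a morphism `s^* a ⟶ t^* b` in the fiber over `V`,
regarded as a morphism between the restrictions of `a` and `b` to `W`. -/
def res {W V X Y : C} (g : W ⟶ V) {s : V ⟶ X} {t : V ⟶ Y} (s' : W ⟶ X) (t' : W ⟶ Y)
    (hs : g ≫ s = s') (ht : g ≫ t = t') {a : p.Fiber X} {b : p.Fiber Y}
    (φ : (pull p s).obj a ⟶ (pull p t).obj b) : (pull p s').obj a ⟶ (pull p t').obj b :=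
  (pullComp p g s s' hs a).inv ≫ (pull p g).map φ ≫ (pullComp p g t t' ht b).hom

end Fibered

/-! ### Stacks -/

section Stacks

variable {C : Type u} [Category.{v} C] {J : Precoverage C} [J.HasPullbacks]

section Overlaps

variable {X : C} (𝒰 : Precoverage.ZeroHypercover.{w} J X)

/-- `U_ij = U_i ×_X U_j` -/
abbrev U₂ (i j : 𝒰.I₀) : C := pullback (𝒰.f i) (𝒰.f j)

/-- `U_ijk = U_i ×_X U_j ×_X U_k` -/
abbrev U₃ (i j k : 𝒰.I₀) : C := pullback (pullback.fst (𝒰.f i) (𝒰.f j) ≫ 𝒰.f i) (𝒰.f k)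

variable (i j k : 𝒰.I₀)

/-- `U_ij ⟶ U_i` -/
abbrev fst₂ : U₂ 𝒰 i j ⟶ 𝒰.X i := pullback.fst _ _

/-- `U_ij ⟶ U_j` -/
abbrev snd₂ : U₂ 𝒰 i j ⟶ 𝒰.X j := pullback.snd _ _

/-- `U_ij ⟶ X` -/
abbrev base₂ : U₂ 𝒰 i j ⟶ X := fst₂ 𝒰 i j ≫ 𝒰.f i

theorem snd₂_f : snd₂ 𝒰 i j ≫ 𝒰.f j = base₂ 𝒰 i j := pullback.condition.symm

/-- `U_ijk ⟶ U_ij` -/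
abbrev proj₁₂ : U₃ 𝒰 i j k ⟶ U₂ 𝒰 i j := pullback.fst _ _

/-- `U_ijk ⟶ U_i` -/
abbrev proj₁ : U₃ 𝒰 i j k ⟶ 𝒰.X i := proj₁₂ 𝒰 i j k ≫ fst₂ 𝒰 i j

/-- `U_ijk ⟶ U_j` -/
abbrev proj₂ : U₃ 𝒰 i j k ⟶ 𝒰.X j := proj₁₂ 𝒰 i j k ≫ snd₂ 𝒰 i j

/-- `U_ijk ⟶ U_k` -/
abbrev proj₃ : U₃ 𝒰 i j k ⟶ 𝒰.X k := pullback.snd _ _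

/-- `U_ijk ⟶ U_jk` -/
abbrev proj₂₃ : U₃ 𝒰 i j k ⟶ U₂ 𝒰 j k :=
  pullback.lift (proj₂ 𝒰 i j k) (proj₃ 𝒰 i j k) (by
    rw [Category.assoc, snd₂_f, pullback.condition])

/-- `U_ijk ⟶ U_ik` -/
abbrev proj₁₃ : U₃ 𝒰 i j k ⟶ U₂ 𝒰 i k :=
  pullback.lift (proj₁ 𝒰 i j k) (proj₃ 𝒰 i j k) (by
    rw [Category.assoc, pullback.condition])

end Overlaps

variable {E : Type u₂} [Category.{v₂} E] (p : E ⥤ C) [IsFiberedInGroupoids p]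

/-- The descent conditions for `p : E ⥤ C` and a single cover `{U_i ⟶ X}`. -/
structure SatisfiesDescent {X : C} (𝒰 : Precoverage.ZeroHypercover.{w} J X) : Prop where
  /-- `Hom(a, b)` is the equalizer of
  `∏ Hom(a|U_i, b|U_i) ⇉ ∏ Hom(a|U_ij, b|U_ij)`. -/
  hom_gluing (a b : p.Fiber X)
    (φ : ∀ i, (pull p (𝒰.f i)).obj a ⟶ (pull p (𝒰.f i)).obj b)
    (hφ : ∀ i j,
      res p (fst₂ 𝒰 i j) (base₂ 𝒰 i j) (base₂ 𝒰 i j) rfl rfl (φ i) =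
        res p (snd₂ 𝒰 i j) (base₂ 𝒰 i j) (base₂ 𝒰 i j)
          (snd₂_f 𝒰 i j) (snd₂_f 𝒰 i j) (φ j)) :
    ∃! ψ : a ⟶ b, ∀ i, (pull p (𝒰.f i)).map ψ = φ i
  /-- Descent data `a_i`, `α_ij : a_i|U_ij ≅ a_j|U_ij` satisfying the cocycle condition
  on `U_ijk` are effective. -/
  obj_gluing (a : ∀ i, p.Fiber (𝒰.X i))
    (α : ∀ i j, (pull p (fst₂ 𝒰 i j)).obj (a i) ≅ (pull p (snd₂ 𝒰 i j)).obj (a j))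
    (cocycle : ∀ i j k,
      res p (proj₁₂ 𝒰 i j k) (proj₁ 𝒰 i j k) (proj₂ 𝒰 i j k) rfl rfl (α i j).hom ≫
        res p (proj₂₃ 𝒰 i j k) (proj₂ 𝒰 i j k) (proj₃ 𝒰 i j k)
          (pullback.lift_fst _ _ _) (pullback.lift_snd _ _ _) (α j k).hom =
      res p (proj₁₃ 𝒰 i j k) (proj₁ 𝒰 i j k) (proj₃ 𝒰 i j k)
          (pullback.lift_fst _ _ _) (pullback.lift_snd _ _ _) (α i k).hom) :
    ∃ (b : p.Fiber X) (β : ∀ i, (pull p (𝒰.f i)).obj b ≅ a i), ∀ i j,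
      ((pullComp p (fst₂ 𝒰 i j) (𝒰.f i) (base₂ 𝒰 i j) rfl b).inv ≫
          (pull p (fst₂ 𝒰 i j)).map (β i).hom) ≫ (α i j).hom =
        (pullComp p (snd₂ 𝒰 i j) (𝒰.f j) (base₂ 𝒰 i j) (snd₂_f 𝒰 i j) b).inv ≫
          (pull p (snd₂ 𝒰 i j)).map (β j).hom

variable (J) in
/-- A category fibered in groupoids is a stack if it satisfies descent for all covers
(with index sets in `Type w`). -/
def IsStack : Prop :=
  ∀ (X : C) (𝒰 : Precoverage.ZeroHypercover.{w} J X), SatisfiesDescent p 𝒰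

end Stacks

/-! ### The groupoids `E(X) = Hom(C/X, E)` -/

section Sections

variable {C : Type u} [Category.{v} C] {E : Type u₂} [Category.{v₂} E]

/-- `E(X)`: the functors `C/X ⥤ E` over `C`, with the natural transformations lying over the
identity of `C` as morphisms. -/
abbrev Sections (p : E ⥤ C) (X : C) :=
  BasedFunctor (BasedCategory.ofFunctor (Over.forget X)) (BasedCategory.ofFunctor p)

instance sectionsGroupoid (p : E ⥤ C) [IsFiberedInGroupoids p] (X : C) :
    Groupoid (Sections p X) :=
  Groupoid.ofIsIso fun {F G} φ => by
    have (a : (BasedCategory.ofFunctor (Over.forget X)).obj) : IsIso (φ.toNatTrans.app a) := by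
      have h := φ.isHomLift' a
      exact @isIso_of_isHomLift_id _ _ _ _ p _ _ _ _ (φ.toNatTrans.app a) h
    have : IsIso (X := F.toFunctor) φ.toNatTrans := NatIso.isIso_of_isIso_app φ.toNatTrans
    exact BasedNatIso.isIso_of_toNatTrans_isIso φ

/-- The functor `C/Y ⥤ C/X` over `C` given by composition with `f : Y ⟶ X`. -/
def overMap {X Y : C} (f : Y ⟶ X) :
    BasedFunctor (BasedCategory.ofFunctor (Over.forget Y))
      (BasedCategory.ofFunctor (Over.forget X)) where
  toFunctor := Over.map f
  w := rfl

theorem basedFunctor_ext {𝒳 : BasedCategory.{v₁, u₁} C} {𝒴 : BasedCategory.{v₂, u₂} C}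
    {F G : BasedFunctor 𝒳 𝒴} (h : F.toFunctor = G.toFunctor) : F = G := by
  cases F; cases G; cases h; rfl

theorem overMap_id (X : C) : overMap (𝟙 X) = BasedFunctor.id _ :=
  basedFunctor_ext (Over.mapId_eq X)

theorem overMap_comp {X Y Z : C} (g : Z ⟶ Y) (f : Y ⟶ X) :
    overMap (g ≫ f) = (overMap g).comp (overMap f) :=
  basedFunctor_ext (Over.mapComp_eq g f)

/-- Precomposition of functors over `C`. -/
def precomp (p : E ⥤ C) {𝒳 : BasedCategory.{v₁, u₁} C} {𝒴 : BasedCategory.{v₁, u₁} C}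
    (H : BasedFunctor 𝒳 𝒴) :
    BasedFunctor 𝒴 (BasedCategory.ofFunctor p) ⥤ BasedFunctor 𝒳 (BasedCategory.ofFunctor p) where
  obj F := H.comp F
  map φ := BasedCategory.whiskerLeft H φ

/-- The restriction functor `E(X) ⥤ E(Y)` along `f : Y ⟶ X`. -/
def restrict (p : E ⥤ C) {X Y : C} (f : Y ⟶ X) : Sections p X ⥤ Sections p Y :=
  precomp p (overMap f)

theorem restrict_id (p : E ⥤ C) (X : C) : restrict p (𝟙 X) = 𝟭 _ := by
  rw [restrict, overMap_id]; rfl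

theorem restrict_comp (p : E ⥤ C) {X Y Z : C} (g : Z ⟶ Y) (f : Y ⟶ X) :
    restrict p (g ≫ f) = restrict p f ⋙ restrict p g := by
  rw [restrict, overMap_comp]; rfl

end Sections

/-! ### Homotopy limits of groupoids -/

section HoLim

/-- The equalizer of two functors in the category of categories. -/
structure StrictEqualizer {A : Type u₁} [Category.{v₁} A] {B : Type u₂} [Category.{v₂} B]
    (P Q : A ⥤ B) where
  obj : A
  eq : P.obj obj = Q.obj obj

namespace StrictEqualizer

variable {A : Type u₁} [Category.{v₁} A] {B : Type u₂} [Category.{v₂} B] {P Q : A ⥤ B}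

/-- A morphism of the equalizer: a morphism of `A` with the same image under both functors. -/
@[ext]
structure Hom (a b : StrictEqualizer P Q) where
  hom : a.obj ⟶ b.obj
  eq : P.map hom = eqToHom a.eq ≫ Q.map hom ≫ eqToHom b.eq.symm

instance : Category (StrictEqualizer P Q) where
  Hom := Hom
  id a := ⟨𝟙 _, by simp⟩
  comp φ ψ := ⟨φ.hom ≫ ψ.hom, by simp [φ.eq, ψ.eq]⟩
  id_comp φ := Hom.ext (Category.id_comp φ.hom)
  comp_id φ := Hom.ext (Category.comp_id φ.hom)
  assoc φ ψ χ := Hom.ext (Category.assoc φ.hom ψ.hom χ.hom)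

end StrictEqualizer

variable {I : Type u₁} [Category.{v₁} I] (X : I ⥤ Grpd.{v, u})

/-- `∏_i X(i)^{N(I/i)}`. The cotensor `G^K` of a groupoid `G` with a simplicial set `K` is the
groupoid of functors to `G` from the fundamental groupoid of `K`; when `K` is the nerve of a
category `D`, the fundamental groupoid is the free groupoid on the category `D`. -/
abbrev HoLimSource := ∀ i : I, FreeGroupoid (Over i) ⥤ X.obj i

/-- `∏_{α : j ⟶ i} X(i)^{N(I/j)}` -/
abbrev HoLimTarget := ∀ α : Arrow I, FreeGroupoid (Over α.left) ⥤ X.obj α.right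

/-- The map with components `X(i)^{N(I/i)} ⥤ X(i)^{N(I/j)}` for `α : j ⟶ i`. -/
def holimLeft : HoLimSource X ⥤ HoLimTarget X :=
  Functor.pi' fun α => Pi.eval _ α.right ⋙
    (whiskeringLeft _ _ _).obj (FreeGroupoid.map (Over.map α.hom))

/-- The map with components `X(j)^{N(I/j)} ⥤ X(i)^{N(I/j)}` for `α : j ⟶ i`. -/
def holimRight : HoLimSource X ⥤ HoLimTarget X :=
  Functor.pi' fun α => Pi.eval _ α.left ⋙
    (whiskeringRight _ _ _).obj (X.map α.hom : X.obj α.left ⥤ X.obj α.right)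

/-- The homotopy limit of a diagram of groupoids: the equalizer of
`∏_i X(i)^{N(I/i)} ⇉ ∏_{α : j ⟶ i} X(i)^{N(I/j)}`. -/
abbrev HoLim := StrictEqualizer (holimLeft X) (holimRight X)

instance : Groupoid (HoLim X) :=
  Groupoid.ofIsIso fun {F G} φ => by
    have : IsIso φ.hom := by
      have (i : I) : IsIso (φ.hom i) := NatIso.isIso_of_isIso_app _
      exact ⟨⟨fun i => inv (φ.hom i), by ext; simp, by ext; simp⟩⟩
    refine ⟨⟨⟨inv φ.hom, ?_⟩, ?_, ?_⟩⟩
    · rw [Functor.map_inv, Functor.map_inv, IsIso.inv_eq_of_hom_inv_id]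
      simp [φ.eq]
    · exact StrictEqualizer.Hom.ext (IsIso.hom_inv_id φ.hom)
    · exact StrictEqualizer.Hom.ext (IsIso.inv_hom_id φ.hom)

theorem toHoLim_aux {G : Type u₂} [Category.{v₂} G] (c : ∀ i : I, G ⥤ X.obj i)
    (hc : ∀ {j i : I} (α : j ⟶ i), c j ⋙ X.map α = c i) {j i : I} (α : j ⟶ i) (g : G) :
    FreeGroupoid.map (Over.map α) ⋙ (Functor.const _).obj ((c i).obj g) =
      (Functor.const _).obj ((c j).obj g) ⋙ (X.map α : X.obj j ⥤ X.obj i) := by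
  rw [← hc α]
  refine CategoryTheory.Functor.ext (fun _ => rfl) (fun _ _ _ => ?_)
  simp

/-- The canonical functor to the homotopy limit induced by a (strict) cone: it sends `g` to the
family of constant functors at the images of `g`. -/
def toHoLim {G : Type u₂} [Category.{v₂} G] (c : ∀ i : I, G ⥤ X.obj i)
    (hc : ∀ {j i : I} (α : j ⟶ i), c j ⋙ X.map α = c i) : G ⥤ HoLim X where
  obj g :=
    { obj := fun i => (Functor.const _).obj ((c i).obj g)
      eq := by
        funext α
        exact toHoLim_aux X c hc α.hom g }
  map {g g'} φ :=
    { hom := fun i => (Functor.const _).map ((c i).map φ)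
      eq := by
        funext α
        ext k
        simp only [Pi.comp_apply, CategoryTheory.Functor.eqToHom_proj, NatTrans.comp_app, eqToHom_app]
        exact CategoryTheory.Functor.congr_hom (hc α.hom).symm φ }
  map_id g := StrictEqualizer.Hom.ext (by funext i; ext; simp; rfl)
  map_comp φ ψ := StrictEqualizer.Hom.ext (by funext i; ext; simp; rfl)

end HoLim

/-! ### The cosimplicial groupoid of a cover -/

section Cech

variable {C : Type u} [Category.{v} C] {J : Precoverage C} [J.HasPullbacks] {X : C}
  (𝒰 : Precoverage.ZeroHypercover.{w} J X)

instance hasWidePullback : ∀ {n : ℕ} (x : Fin (n + 1) → 𝒰.I₀),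
    HasWidePullback X (fun k => 𝒰.X (x k)) (fun k => 𝒰.f (x k))
  | 0, x => by
    refine ⟨⟨⟨WidePullbackCone.mk (𝒰.f (x 0))
      (Fin.cases (𝟙 _) (fun k => k.elim0)) ?_, ?_⟩⟩⟩
    · exact Fin.cases (Category.id_comp _) (fun k => k.elim0)
    · refine WidePullbackCone.IsLimit.mk _ (fun t => t.π 0) ?_ ?_ ?_
      · intro t
        exact t.condition 0
      · intro t
        exact Fin.cases (Category.comp_id _) (fun k => k.elim0)
      · intro t m _ h
        exact (Category.comp_id _).symm.trans (h 0)
  | n + 1, x => by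
    have := hasWidePullback (fun k : Fin (n + 1) => x k.succ)
    let b := WidePullback.base (fun k : Fin (n + 1) => 𝒰.f (x k.succ))
    let q₁ := pullback.fst (𝒰.f (x 0)) b
    let q₂ := pullback.snd (𝒰.f (x 0)) b
    have hq : q₁ ≫ 𝒰.f (x 0) = q₂ ≫ b := pullback.condition
    refine ⟨⟨⟨WidePullbackCone.mk (q₁ ≫ 𝒰.f (x 0))
      (Fin.cases q₁ (fun k => q₂ ≫ WidePullback.π _ k)) ?_, ?_⟩⟩⟩
    · refine Fin.cases rfl (fun k => ?_)
      rw [hq]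
      exact (Category.assoc _ _ _).trans (congrArg (q₂ ≫ ·) (WidePullback.π_arrow _ k))
    · let L (t : WidePullbackCone (fun k => 𝒰.f (x k))) :=
        WidePullback.lift (arrows := fun k : Fin (n + 1) => 𝒰.f (x k.succ)) t.base
          (fun k => t.π k.succ) (fun k => t.condition k.succ)
      have hL (t : WidePullbackCone (fun k => 𝒰.f (x k))) : t.π 0 ≫ 𝒰.f (x 0) = L t ≫ b :=
        (t.condition 0).trans (WidePullback.lift_base _ _ _ _).symm
      have hLπ (t : WidePullbackCone (fun k => 𝒰.f (x k))) (k : Fin (n + 1)) :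
          L t ≫ WidePullback.π (fun k : Fin (n + 1) => 𝒰.f (x k.succ)) k = t.π k.succ :=
        WidePullback.lift_π (fun k : Fin (n + 1) => 𝒰.f (x k.succ)) _ _ _ k
      have h₁ t : pullback.lift _ _ (hL t) ≫ q₁ = t.π 0 := pullback.lift_fst _ _ _
      have h₂ t : pullback.lift _ _ (hL t) ≫ q₂ = L t := pullback.lift_snd _ _ _
      refine WidePullbackCone.IsLimit.mk _ (fun t => pullback.lift _ _ (hL t)) ?_ ?_ ?_
      · intro t
        exact (Category.assoc _ _ _).symm.trans ((congrArg (· ≫ 𝒰.f (x 0)) (h₁ t)).trans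
          (t.condition 0))
      · intro t
        refine Fin.cases (h₁ t) (fun k => ?_)
        exact (Category.assoc _ _ _).symm.trans
          ((congrArg (· ≫ WidePullback.π _ k) (h₂ t)).trans (hLπ t k))
      · intro t m hb h
        apply pullback.hom_ext
        · exact (h 0).trans (h₁ t).symm
        · refine Eq.trans ?_ (h₂ t).symm
          apply WidePullback.hom_ext
          · intro k
            refine (Category.assoc _ _ _).trans ((h k.succ).trans ?_)
            exact (hLπ t k).symm
          · refine (Category.assoc _ _ _).trans ?_
            refine Eq.trans ?_ (WidePullback.lift_base _ _ _ _).symm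
            rw [← hb]
            exact congrArg (m ≫ ·) hq.symm

/-- `U_{i_0 … i_n} = U_{i_0} ×_X ⋯ ×_X U_{i_n}` -/
abbrev cechObj {n : ℕ} (x : Fin (n + 1) → 𝒰.I₀) : C :=
  widePullback X (fun k => 𝒰.X (x k)) (fun k => 𝒰.f (x k))

/-- The structure map `U_{i_0 … i_n} ⟶ X` -/
abbrev cechBase {n : ℕ} (x : Fin (n + 1) → 𝒰.I₀) : cechObj 𝒰 x ⟶ X :=
  WidePullback.base (fun k => 𝒰.f (x k))

/-- The simplicial structure of the nerve of the cover: for `σ : [m] ⟶ [n]` the map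
`U_{i_0 … i_n} ⟶ U_{i_σ(0) … i_σ(m)}` whose `k`-th component is the `σ(k)`-th projection. -/
def cechMap {m n : ℕ} (σ : Fin (m + 1) → Fin (n + 1)) (x : Fin (n + 1) → 𝒰.I₀) :
    cechObj 𝒰 x ⟶ cechObj 𝒰 (x ∘ σ) :=
  WidePullback.lift (cechBase 𝒰 x) (fun k => WidePullback.π (fun k => 𝒰.f (x k)) (σ k))
    (fun k => WidePullback.π_arrow _ (σ k))

theorem cechMap_base {m n : ℕ} (σ : Fin (m + 1) → Fin (n + 1)) (x : Fin (n + 1) → 𝒰.I₀) :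
    cechMap 𝒰 σ x ≫ cechBase 𝒰 (x ∘ σ) = cechBase 𝒰 x :=
  WidePullback.lift_base _ _ _ _

theorem cechMap_id {n : ℕ} (x : Fin (n + 1) → 𝒰.I₀) :
    cechMap 𝒰 (fun k => k) x = 𝟙 (cechObj 𝒰 x) := by
  apply WidePullback.hom_ext
  · intro k
    exact (WidePullback.lift_π _ _ _ _ _).trans (Category.id_comp _).symm
  · exact (WidePullback.lift_base _ _ _ _).trans (Category.id_comp _).symm

theorem cechMap_comp {l m n : ℕ} (τ : Fin (l + 1) → Fin (m + 1)) (σ : Fin (m + 1) → Fin (n + 1))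
    (x : Fin (n + 1) → 𝒰.I₀) :
    cechMap 𝒰 (fun k => σ (τ k)) x = cechMap 𝒰 σ x ≫ cechMap 𝒰 τ (x ∘ σ) := by
  apply WidePullback.hom_ext
  · intro k
    rw [Category.assoc]
    erw [WidePullback.lift_π, WidePullback.lift_π, WidePullback.lift_π]
  · rw [Category.assoc]
    erw [cechMap_base, cechMap_base, cechMap_base]

variable {E : Type u₂} [Category.{v₂} E] (p : E ⥤ C)

variable (n : ℕ) in
/-- `∏ E(U_{i_0 … i_n})`, the product being taken over all multi-indices. -/
abbrev CechSections : Type _ := ∀ x : Fin (n + 1) → 𝒰.I₀, Sections p (cechObj 𝒰 x)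

/-- The functor `∏ E(U_{i_0 … i_m}) ⥤ ∏ E(U_{i_0 … i_n})` induced by `σ : [m] ⟶ [n]`. -/
def cechRestrict {m n : ℕ} (σ : Fin (m + 1) → Fin (n + 1)) :
    CechSections 𝒰 p m ⥤ CechSections 𝒰 p n :=
  Functor.pi' fun x => Pi.eval _ (x ∘ σ) ⋙ restrict p (cechMap 𝒰 σ x)

theorem cechRestrict_id (n : ℕ) :
    cechRestrict 𝒰 p (fun k : Fin (n + 1) => k) = 𝟭 (CechSections 𝒰 p n) := by
  have h : (fun x : Fin (n + 1) → 𝒰.I₀ =>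
      Pi.eval (fun x => Sections p (cechObj 𝒰 x)) x ⋙ restrict p (cechMap 𝒰 (fun k => k) x)) =
      fun x => Pi.eval (fun x => Sections p (cechObj 𝒰 x)) x ⋙ 𝟭 _ := by
    funext x
    rw [← restrict_id, ← cechMap_id]
  exact congrArg Functor.pi' h

theorem cechRestrict_comp {l m n : ℕ} (τ : Fin (l + 1) → Fin (m + 1))
    (σ : Fin (m + 1) → Fin (n + 1)) :
    cechRestrict 𝒰 p (fun k => σ (τ k)) = cechRestrict 𝒰 p τ ⋙ cechRestrict 𝒰 p σ := by
  have h : (fun x : Fin (n + 1) → 𝒰.I₀ =>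
      Pi.eval (fun x => Sections p (cechObj 𝒰 x)) (fun k => x (σ (τ k))) ⋙
        restrict p (cechMap 𝒰 (fun k => σ (τ k)) x)) =
      fun x => Pi.eval (fun x => Sections p (cechObj 𝒰 x)) (fun k => x (σ (τ k))) ⋙
        restrict p (cechMap 𝒰 τ (x ∘ σ)) ⋙ restrict p (cechMap 𝒰 σ x) := by
    funext x
    rw [← restrict_comp, ← cechMap_comp]
  exact congrArg Functor.pi' h

/-- The cosimplicial groupoid `∏ E(U_i) ⇉ ∏ E(U_ij) ⇛ ∏ E(U_ijk) ⋯`. -/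
def cechGroupoid [IsFiberedInGroupoids p] :
    CosimplicialObject Grpd.{max u v v₂ w, max u v u₂ v₂ w} where
  obj n := Grpd.of (CechSections 𝒰 p n.len)
  map σ := cechRestrict 𝒰 p σ.toOrderHom
  map_id n := cechRestrict_id 𝒰 p n.len
  map_comp τ σ := cechRestrict_comp 𝒰 p τ.toOrderHom σ.toOrderHom

/-- The canonical map `E(X) ⥤ holim (∏ E(U_i) ⇉ ∏ E(U_ij) ⇛ ∏ E(U_ijk) ⋯)`, induced by the
restrictions along `U_{i_0 … i_n} ⟶ X`. -/
def comparison [IsFiberedInGroupoids p] : Sections p X ⥤ HoLim (cechGroupoid 𝒰 p) :=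
  toHoLim (cechGroupoid 𝒰 p) (fun _ => Functor.pi' fun x => restrict p (cechBase 𝒰 x))
    (fun {_ n} σ => congrArg Functor.pi' (funext fun x : Fin (n.len + 1) → 𝒰.I₀ =>
      (restrict_comp p _ _).symm.trans (congrArg (restrict p) (cechMap_base 𝒰 σ.toOrderHom x))))

end Cech

end HomotopySheaf

end

/-!
A section of `E` over `X` is determined up to isomorphism by its value at `𝟙 X`. For a cover `𝒰`
of `X`, consider the category whose objects are the objects of `C/X` equipped with finitely many
points in members of `𝒰`; it is the total category of a simplicial category over `C`. Both sides
of the theorem compare `E(X)` with the functors over `C` from this category to `E`: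

* such a functor is determined by its restriction to dimensions `≤ 2`, where it is a descent datum;
* the homotopy limit of a diagram of groupoids is the groupoid of its pseudocones, the pseudocones
  over the functors on the `n`-simplices are the functors on the total category, and the category of
  `n`-simplices is equivalent to the disjoint union of the categories `C/U_{i_0 … i_n}`.
-/

noncomputable section

namespace HomotopySheaf

open CategoryTheory.Functor.Fiber (fiberInclusion)
open scoped Simplicial

/-! ### Functors over a base -/

section FunOver

variable {C : Type u} [Category.{v} C] {E : Type u₂} [Category.{v₂} E]
  {D : Type u₁} [Category.{v₁} D]

/-- The functors `D ⥤ E` over `C`; for `D = C/X` these are the sections of `p` over `X`. -/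
abbrev FunOver (π : D ⥤ C) (p : E ⥤ C) :=
  BasedFunctor (BasedCategory.ofFunctor π) (BasedCategory.ofFunctor p)

namespace FunOver

variable {π : D ⥤ C} {p : E ⥤ C}

/-- The underlying functor of a functor over `C`, with its source and target unbundled. -/
def fn (F : FunOver π p) : D ⥤ E := F.toFunctor

theorem proj_obj (F : FunOver π p) (d : D) : p.obj (F.fn.obj d) = π.obj d :=
  BasedFunctor.w_obj F d

instance isHomLift_map (F : FunOver π p) {d e : D} (f : d ⟶ e) :
    p.IsHomLift (π.map f) (F.fn.map f) :=
  have : (BasedCategory.ofFunctor π).p.IsHomLift (π.map f) f := IsHomLift.map π f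
  BasedFunctor.preserves_isHomLift F (π.map f) f

/-- A functor over `C` from a functor lifting each object and each morphism of its source. -/
def ofIsHomLift (F : D ⥤ E) (hF : ∀ {d e : D} (f : d ⟶ e), p.IsHomLift (π.map f) (F.map f)) :
    FunOver π p where
  toFunctor := F
  w := by
    have hobj (d : D) : p.obj (F.obj d) = π.obj d :=
      have := hF (𝟙 d)
      IsHomLift.domain_eq p (π.map (𝟙 d)) (F.map (𝟙 d))
    refine CategoryTheory.Functor.ext hobj fun d e f => ?_
    have := hF f
    exact IsHomLift.fac' p (π.map f) (F.map f)

/-- The component at `d` of a morphism of functors over `C`. -/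
def app {F G : FunOver π p} (φ : F ⟶ G) (d : D) : F.fn.obj d ⟶ G.fn.obj d :=
  φ.toNatTrans.app d

instance isHomLift_app {F G : FunOver π p} (φ : F ⟶ G) (d : D) :
    p.IsHomLift (𝟙 (π.obj d)) (app φ d) := φ.isHomLift' d

theorem naturality {F G : FunOver π p} (φ : F ⟶ G) {d e : D} (f : d ⟶ e) :
    F.fn.map f ≫ app φ e = app φ d ≫ G.fn.map f := φ.toNatTrans.naturality f

theorem hom_ext {F G : FunOver π p} {φ ψ : F ⟶ G} (h : ∀ d, app φ d = app ψ d) : φ = ψ :=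
  BasedNatTrans.homCategory.ext φ ψ (NatTrans.ext (funext h))

/-- A morphism of functors over `C` from its components. -/
def homMk {F G : FunOver π p} (app : ∀ d, F.fn.obj d ⟶ G.fn.obj d)
    (naturality : ∀ {d e : D} (f : d ⟶ e), F.fn.map f ≫ app e = app d ≫ G.fn.map f)
    (h : ∀ d, p.IsHomLift (𝟙 (π.obj d)) (app d)) : F ⟶ G where
  toNatTrans := { app := app, naturality := fun _ _ f => naturality f }
  isHomLift' := h

instance isIso_app [IsFiberedInGroupoids p] {F G : FunOver π p} (φ : F ⟶ G) (d : D) :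
    IsIso (app φ d) :=
  isIso_of_isHomLift_id p (X := π.obj d) _

theorem isIso_of_hom [IsFiberedInGroupoids p] {F G : FunOver π p} (φ : F ⟶ G) : IsIso φ := by
  have : IsIso (X := F.toFunctor) φ.toNatTrans :=
    have (d : (BasedCategory.ofFunctor π).obj) : IsIso (φ.toNatTrans.app d) := isIso_app φ d
    NatIso.isIso_of_isIso_app φ.toNatTrans
  exact BasedNatIso.isIso_of_toNatTrans_isIso φ

end FunOver

end FunOver

/-! ### Lifting morphisms -/

section Lift

variable {C : Type u} [Category.{v} C] {E : Type u₂} [Category.{v₂} E]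

theorem isHomLift_comp (p : E ⥤ C) {R S T : C} {a b c : E} (f : R ⟶ S) (g : S ⟶ T) (h : R ⟶ T)
    (w : f ≫ g = h) (φ : a ⟶ b) (ψ : b ⟶ c) [p.IsHomLift f φ] [p.IsHomLift g ψ] :
    p.IsHomLift h (φ ≫ ψ) := by
  subst w; infer_instance

variable (p : E ⥤ C) [IsFiberedInGroupoids p]

theorem eq_of_comp_eq {R S : C} {a b c : E} (f : R ⟶ S) {φ φ' : a ⟶ b} (χ : b ⟶ c)
    (h : φ ≫ χ = φ' ≫ χ) (h₁ : p.IsHomLift f φ := by infer_instance)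
    (h₂ : p.IsHomLift f φ' := by infer_instance) : φ = φ' := by
  obtain rfl := IsHomLift.codomain_eq p f φ
  have := isStronglyCartesian p (p.map χ) χ
  exact IsStronglyCartesian.ext p (p.map χ) χ f h

variable {R S T : C} {a b c : E} (f : R ⟶ S) (g : S ⟶ T) (h : R ⟶ T) (w : f ≫ g = h)
  (χ : b ⟶ c) [p.IsHomLift g χ] (ψ : a ⟶ c) [p.IsHomLift h ψ]

/-- The unique lift of `f` through which a lift `ψ` of `f ≫ g` factors over a lift `χ` of `g`. -/
def factor : a ⟶ b :=
  have := isStronglyCartesian p g χ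
  IsStronglyCartesian.map p g χ w.symm ψ

instance isHomLift_factor : p.IsHomLift f (factor p f g h w χ ψ) := by
  have := isStronglyCartesian p g χ
  unfold factor
  infer_instance

theorem factor_comp : factor p f g h w χ ψ ≫ χ = ψ := by
  have := isStronglyCartesian p g χ
  exact IsStronglyCartesian.fac p g χ w.symm ψ

end Lift

/-! ### Chosen pullbacks and restrictions -/

section Pull

variable {C : Type u} [Category.{v} C] {E : Type u₂} [Category.{v₂} E]
  (p : E ⥤ C) [IsFiberedInGroupoids p]

section

variable {X Y : C} (f : Y ⟶ X)

/-- The chosen morphism `f^* a ⟶ a` over `f`, as a morphism from the value of the functor `f^*`. -/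
def proj (a : p.Fiber X) : fiberInclusion.obj ((pull p f).obj a) ⟶ fiberInclusion.obj a :=
  pullProj f a

instance isHomLift_proj (a : p.Fiber X) : p.IsHomLift f (proj p f a) :=
  (pullProj_isCartesian p f a).toIsHomLift

instance isIso_proj_id (a : p.Fiber X) : IsIso (proj p (𝟙 X) a) :=
  isIso_of_isHomLift_id p (X := X) _

theorem pull_map_proj {a b : p.Fiber X} (φ : a ⟶ b) :
    fiberInclusion.map ((pull p f).map φ) ≫ proj p f b = proj p f a ≫ fiberInclusion.map φ :=
  have : p.IsHomLift f (pullProj f a ≫ φ.1) :=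
    inferInstanceAs (p.IsHomLift f (proj p f a ≫ fiberInclusion.map φ))
  pullLift_proj p f b (pullObj f a) (pullProj f a ≫ φ.1)

instance pull_id_faithful : (pull p (𝟙 X)).Faithful where
  map_injective {a b φ ψ} h :=
    Fiber.hom_ext ((cancel_epi (proj p (𝟙 X) a)).1 (by
      rw [← pull_map_proj, h, pull_map_proj]))

instance pull_id_full : (pull p (𝟙 X)).Full where
  map_surjective {a b} χ := by
    let ψ : fiberInclusion.obj a ⟶ fiberInclusion.obj b :=
      inv (proj p (𝟙 X) a) ≫ fiberInclusion.map χ ≫ proj p (𝟙 X) b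
    have lift_ψ : p.IsHomLift (𝟙 X) ψ := inferInstance
    refine ⟨⟨ψ, lift_ψ⟩, Fiber.hom_ext (eq_of_comp_eq p (𝟙 X) (proj p (𝟙 X) b) ?_)⟩
    exact (pull_map_proj p (𝟙 X) _).trans (IsIso.hom_inv_id_assoc _ _)

end

section

variable {X Y Z : C} (g : Z ⟶ Y) (f : Y ⟶ X) (h : Z ⟶ X) (w : g ≫ f = h)

/-- The canonical morphism `h^* a ⟶ f^* a` over `g`, where `h` is the composite of `g` and `f`. -/
def pullTrans (a : p.Fiber X) :
    fiberInclusion.obj ((pull p h).obj a) ⟶ fiberInclusion.obj ((pull p f).obj a) :=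
  factor p g f h w (proj p f a) (proj p h a)

instance isHomLift_pullTrans (a : p.Fiber X) : p.IsHomLift g (pullTrans p g f h w a) :=
  isHomLift_factor p g f h w _ _

theorem pullTrans_proj (a : p.Fiber X) : pullTrans p g f h w a ≫ proj p f a = proj p h a :=
  factor_comp p g f h w _ _

theorem pullTrans_comp {W : C} (k : W ⟶ Z) (h' : W ⟶ X) (w' : k ≫ h = h') (kg : W ⟶ Y)
    (w'' : k ≫ g = kg) (a : p.Fiber X) :
    pullTrans p k h h' w' a ≫ pullTrans p g f h w a =
      pullTrans p kg f h' (by rw [← w'', Category.assoc, w, w']) a := by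
  have := isHomLift_comp p k g kg w'' (pullTrans p k h h' w' a) (pullTrans p g f h w a)
  refine eq_of_comp_eq p kg (proj p f a) ?_
  rw [Category.assoc, pullTrans_proj, pullTrans_proj, pullTrans_proj]

theorem pullTrans_id (a : p.Fiber X) : pullTrans p (𝟙 Y) f f (Category.id_comp f) a = 𝟙 _ := by
  have : p.IsHomLift (𝟙 Y) (𝟙 (fiberInclusion.obj ((pull p f).obj a))) :=
    IsHomLift.id ((pull p f).obj a).2
  refine eq_of_comp_eq p (𝟙 Y) (proj p f a) ?_
  rw [pullTrans_proj, Category.id_comp]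

theorem pull_map_trans {a b : p.Fiber X} (φ : a ⟶ b) :
    fiberInclusion.map ((pull p h).map φ) ≫ pullTrans p g f h w b =
      pullTrans p g f h w a ≫ fiberInclusion.map ((pull p f).map φ) := by
  refine eq_of_comp_eq p g (proj p f b) ?_
  rw [Category.assoc, Category.assoc, pullTrans_proj, pull_map_proj, pull_map_proj,
    reassoc_of% pullTrans_proj p g f h w a]

theorem pull_map_eq_of_comp_trans {a b : p.Fiber X} (φ : a ⟶ b)
    (η : fiberInclusion.obj ((pull p f).obj a) ⟶ fiberInclusion.obj ((pull p f).obj b))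
    (hη : p.IsHomLift (𝟙 Y) η)
    (h : pullTrans p f (𝟙 X) f (Category.comp_id f) a ≫ fiberInclusion.map ((pull p (𝟙 X)).map φ) =
      η ≫ pullTrans p f (𝟙 X) f (Category.comp_id f) b) :
    fiberInclusion.map ((pull p f).map φ) = η := by
  refine eq_of_comp_eq p (𝟙 Y) (pullTrans p f (𝟙 X) f (Category.comp_id f) b) ?_
  rw [pull_map_trans, h]

theorem pullComp_hom_trans (a : p.Fiber X) :
    fiberInclusion.map (pullComp p g f h w a).hom ≫ pullTrans p g f h w a =
      proj p g ((pull p f).obj a) := by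
  have : p.IsHomLift h (pullProj g (pullObj f a) ≫ pullProj f a) := by
    subst w; infer_instance
  refine eq_of_comp_eq p g (proj p f a) ?_
  rw [Category.assoc, pullTrans_proj]
  exact pullLift_proj p h a (pullObj g (pullObj f a)) (pullProj g (pullObj f a) ≫ pullProj f a)

theorem pullComp_inv_proj (a : p.Fiber X) :
    fiberInclusion.map (pullComp p g f h w a).inv ≫ proj p g ((pull p f).obj a) =
      pullTrans p g f h w a := by
  rw [← pullComp_hom_trans p g f h w a, ← Category.assoc, ← Functor.map_comp, Iso.inv_hom_id,
    CategoryTheory.Functor.map_id, Category.id_comp]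

end

section Res

variable {W V X Y : C} (g : W ⟶ V) {s : V ⟶ X} {t : V ⟶ Y} (s' : W ⟶ X) (t' : W ⟶ Y)
    (hs : g ≫ s = s') (ht : g ≫ t = t') {a : p.Fiber X} {b : p.Fiber Y}

theorem res_trans (φ : (pull p s).obj a ⟶ (pull p t).obj b) :
    fiberInclusion.map (res p g s' t' hs ht φ) ≫ pullTrans p g t t' ht b =
      pullTrans p g s s' hs a ≫ fiberInclusion.map φ := by
  rw [res, Functor.map_comp, Functor.map_comp, Category.assoc, Category.assoc, pullComp_hom_trans,
    pull_map_proj, reassoc_of% pullComp_inv_proj p g s s' hs a]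

theorem res_eq (φ : (pull p s).obj a ⟶ (pull p t).obj b)
    (χ : (pull p s').obj a ⟶ (pull p t').obj b)
    (h : fiberInclusion.map χ ≫ pullTrans p g t t' ht b =
      pullTrans p g s s' hs a ≫ fiberInclusion.map φ) :
    res p g s' t' hs ht φ = χ := by
  refine Fiber.hom_ext (eq_of_comp_eq p (𝟙 W) (pullTrans p g t t' ht b) ?_)
  rw [res_trans, h]

theorem res_comp {Z : C} {r : V ⟶ Z} (r' : W ⟶ Z) (hr : g ≫ r = r') {c : p.Fiber Z}
    (φ : (pull p s).obj a ⟶ (pull p t).obj b) (ψ : (pull p t).obj b ⟶ (pull p r).obj c) :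
    res p g s' r' hs hr (φ ≫ ψ) = res p g s' t' hs ht φ ≫ res p g t' r' ht hr ψ := by
  apply res_eq
  rw [Functor.map_comp, Functor.map_comp, Category.assoc, res_trans,
    reassoc_of% res_trans p g s' t' hs ht φ]

theorem res_res {W' : C} (k : W' ⟶ W) (s'' : W' ⟶ X) (t'' : W' ⟶ Y) (hs' : k ≫ s' = s'')
    (ht' : k ≫ t' = t'') (kg : W' ⟶ V) (w : k ≫ g = kg)
    (φ : (pull p s).obj a ⟶ (pull p t).obj b) :
    res p k s'' t'' hs' ht' (res p g s' t' hs ht φ) =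
      res p kg s'' t'' (by rw [← w, Category.assoc, hs, hs'])
        (by rw [← w, Category.assoc, ht, ht']) φ := by
  symm
  apply res_eq
  rw [← pullTrans_comp p g t t' ht k t'' ht' kg w, ← pullTrans_comp p g s s' hs k s'' hs' kg w,
    reassoc_of% res_trans p k s'' t'' hs' ht' (res p g s' t' hs ht φ), Category.assoc, res_trans]

theorem res_id (φ : (pull p s).obj a ⟶ (pull p t).obj b) :
    res p (𝟙 V) s t (Category.id_comp s) (Category.id_comp t) φ = φ :=
  res_eq p _ _ _ _ _ _ _ (by rw [pullTrans_id, pullTrans_id, Category.id_comp, Category.comp_id])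

theorem res_pull_map {b : p.Fiber X} (φ : a ⟶ b) :
    res p g s' s' hs hs ((pull p s).map φ) = (pull p s').map φ :=
  res_eq p _ _ _ _ _ _ _ (pull_map_trans p g s s' hs φ)

end Res

end Pull

/-! ### The sections over `X` and the fiber over `X` -/

section Yoneda

variable {C : Type u} [Category.{v} C] {E : Type u₂} [Category.{v₂} E]
  (p : E ⥤ C) [IsFiberedInGroupoids p] (X : C)

/-- The section over `C/X` given by the chosen pullbacks of an object over `X`. -/
def twoYonedaObj (a : p.Fiber X) : FunOver (Over.forget X) p :=
  FunOver.ofIsHomLift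
    { obj := fun u => fiberInclusion.obj ((pull p u.hom).obj a)
      map := fun {u u'} h => pullTrans p h.left u'.hom u.hom (Over.w h) a
      map_id := fun u => pullTrans_id p u.hom a
      map_comp := fun {u u' u''} h h' =>
        (pullTrans_comp p h'.left u''.hom u'.hom (Over.w h') h.left u.hom (Over.w h) _ rfl a).symm }
    (fun h => isHomLift_pullTrans p h.left _ _ (Over.w h) a)

/-- The 2-Yoneda functor from the fiber over `X` to the sections over `C/X`, given by chosen
pullbacks. -/
def twoYoneda : p.Fiber X ⥤ FunOver (Over.forget X) p where
  obj a := twoYonedaObj p X a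
  map {a b} φ := FunOver.homMk (F := twoYonedaObj p X a) (G := twoYonedaObj p X b)
    (fun u => fiberInclusion.map ((pull p u.hom).map φ))
    (fun h => (pull_map_trans p h.left _ _ (Over.w h) φ).symm)
    (fun u => inferInstanceAs (p.IsHomLift (𝟙 u.left) (fiberInclusion.map ((pull p u.hom).map φ))))
  map_id a := FunOver.hom_ext fun u => congrArg fiberInclusion.map ((pull p u.hom).map_id a)
  map_comp φ ψ := FunOver.hom_ext fun u =>
    congrArg fiberInclusion.map ((pull p u.hom).map_comp φ ψ)

instance : (twoYoneda p X).Faithful where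
  map_injective h := (pull p (𝟙 X)).map_injective (fiberInclusion.map_injective
    (congrArg (fun η => FunOver.app η (Over.mk (𝟙 X))) h))

instance : (twoYoneda p X).Full where
  map_surjective {a b} η := by
    obtain ⟨φ, hφ⟩ := (pull p (𝟙 X)).map_surjective (X := a) (Y := b)
      ⟨FunOver.app η (Over.mk (𝟙 X)), FunOver.isHomLift_app η (Over.mk (𝟙 X))⟩
    refine ⟨φ, FunOver.hom_ext fun u => ?_⟩
    refine pull_map_eq_of_comp_trans p u.hom φ _ (FunOver.isHomLift_app η u) ?_
    rw [hφ]
    exact FunOver.naturality η (Over.homMk u.hom : u ⟶ Over.mk (𝟙 X))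

instance : (twoYoneda p X).EssSurj where
  mem_essImage F := by
    let a : p.Fiber X := ⟨F.fn.obj (Over.mk (𝟙 X)), F.proj_obj (Over.mk (𝟙 X))⟩
    let m (u : Over X) : F.fn.obj u ⟶ fiberInclusion.obj a :=
      F.fn.map (Over.homMk u.hom : u ⟶ Over.mk (𝟙 X))
    have lift_m (u : Over X) : p.IsHomLift u.hom (m u) :=
      F.isHomLift_map (Over.homMk u.hom : u ⟶ Over.mk (𝟙 X))
    have map_m {u u' : Over X} (h : u ⟶ u') : F.fn.map h ≫ m u' = m u :=
      (F.fn.map_comp _ _).symm.trans (congrArg F.fn.map (by ext; simp))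
    let e (u : Over X) : fiberInclusion.obj ((pull p u.hom).obj a) ⟶ F.fn.obj u :=
      factor p (𝟙 u.left) u.hom u.hom (Category.id_comp _) (m u) (proj p u.hom a)
    have e_m (u : Over X) : e u ≫ m u = proj p u.hom a := factor_comp p _ _ _ _ _ _
    have lift_e (u : Over X) : p.IsHomLift (𝟙 u.left) (e u) := isHomLift_factor p _ _ _ _ _ _
    let η : (twoYoneda p X).obj a ⟶ F := FunOver.homMk e
      (fun {u u'} h => by
        have : p.IsHomLift h.left (F.fn.map h) := F.isHomLift_map h
        change pullTrans p h.left u'.hom u.hom (Over.w h) a ≫ e u' = e u ≫ F.fn.map h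
        refine eq_of_comp_eq p h.left (m u') ?_
        rw [Category.assoc, Category.assoc, e_m, map_m, e_m, pullTrans_proj])
      lift_e
    have := FunOver.isIso_of_hom η
    exact ⟨a, ⟨asIso η⟩⟩

instance : (twoYoneda p X).IsEquivalence where

end Yoneda

/-! ### Descent data -/

section Descent

variable {C : Type u} [Category.{v} C] {J : Precoverage C} [J.HasPullbacks] {X : C}
  (𝒰 : Precoverage.ZeroHypercover.{w} J X)
  {E : Type u₂} [Category.{v₂} E] (p : E ⥤ C) [IsFiberedInGroupoids p]

/-- A descent datum for `p` and a cover: objects over the `U_i` with isomorphisms between their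
restrictions to the `U_ij` which satisfy the cocycle condition on the `U_ijk`. -/
structure DescentDatum where
  obj (i : 𝒰.I₀) : p.Fiber (𝒰.X i)
  iso (i j : 𝒰.I₀) : (pull p (fst₂ 𝒰 i j)).obj (obj i) ≅ (pull p (snd₂ 𝒰 i j)).obj (obj j)
  cocycle (i j k : 𝒰.I₀) :
    res p (proj₁₂ 𝒰 i j k) (proj₁ 𝒰 i j k) (proj₂ 𝒰 i j k) rfl rfl (iso i j).hom ≫
      res p (proj₂₃ 𝒰 i j k) (proj₂ 𝒰 i j k) (proj₃ 𝒰 i j k)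
        (pullback.lift_fst _ _ _) (pullback.lift_snd _ _ _) (iso j k).hom =
    res p (proj₁₃ 𝒰 i j k) (proj₁ 𝒰 i j k) (proj₃ 𝒰 i j k)
      (pullback.lift_fst _ _ _) (pullback.lift_snd _ _ _) (iso i k).hom

namespace DescentDatum

variable {𝒰 p}

/-- A morphism of descent data: a family of morphisms over the `U_i` which is compatible with the
gluing isomorphisms. -/
@[ext]
structure Hom (D D' : DescentDatum 𝒰 p) where
  app (i : 𝒰.I₀) : D.obj i ⟶ D'.obj i
  comm (i j : 𝒰.I₀) : (pull p (fst₂ 𝒰 i j)).map (app i) ≫ (D'.iso i j).hom =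
    (D.iso i j).hom ≫ (pull p (snd₂ 𝒰 i j)).map (app j)

instance : Category (DescentDatum 𝒰 p) where
  Hom := Hom
  id D := ⟨fun _ => 𝟙 _, fun _ _ => by simp⟩
  comp φ ψ := ⟨fun i => φ.app i ≫ ψ.app i, fun i j => by
    rw [Functor.map_comp, Functor.map_comp, Category.assoc, ψ.comm, reassoc_of% φ.comm i j]⟩

/-- The component of a morphism of descent data over `U_i`. -/
def app {D D' : DescentDatum 𝒰 p} (φ : D ⟶ D') (i : 𝒰.I₀) : D.obj i ⟶ D'.obj i := Hom.app φ i

theorem comm {D D' : DescentDatum 𝒰 p} (φ : D ⟶ D') (i j : 𝒰.I₀) :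
    (pull p (fst₂ 𝒰 i j)).map (app φ i) ≫ (D'.iso i j).hom =
      (D.iso i j).hom ≫ (pull p (snd₂ 𝒰 i j)).map (app φ j) := Hom.comm φ i j

theorem hom_ext {D D' : DescentDatum 𝒰 p} {φ ψ : D ⟶ D'} (h : ∀ i, app φ i = app ψ i) : φ = ψ :=
  Hom.ext (funext h)

theorem hom_ext_iff {D D' : DescentDatum 𝒰 p} {φ ψ : D ⟶ D'} :
    φ = ψ ↔ ∀ i, app φ i = app ψ i :=
  ⟨by rintro rfl i; rfl, hom_ext⟩

theorem isIso_of_hom {D D' : DescentDatum 𝒰 p} (φ : D ⟶ D') : IsIso φ := by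
  let ψ : D' ⟶ D := ⟨fun i => inv (app φ i), fun i j => by
    rw [Functor.map_inv, Functor.map_inv, IsIso.inv_comp_eq, ← Category.assoc, IsIso.eq_comp_inv,
      comm]⟩
  exact ⟨ψ, hom_ext fun _ => IsIso.hom_inv_id _, hom_ext fun _ => IsIso.inv_hom_id _⟩

end DescentDatum

/-- The canonical isomorphism between the restrictions to `V` of the restrictions to `U` and `U'`
of an object over `X`. -/
def pullCompIso {V U U' X : C} {s : V ⟶ U} {t : V ⟶ U'} (f : U ⟶ X) (f' : U' ⟶ X) (r : V ⟶ X)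
    (hs : s ≫ f = r) (ht : t ≫ f' = r) (b : p.Fiber X) :
    (pull p s).obj ((pull p f).obj b) ≅ (pull p t).obj ((pull p f').obj b) :=
  pullComp p s f r hs b ≪≫ (pullComp p t f' r ht b).symm

theorem pullComp_trans {W V U X : C} (g : W ⟶ V) {s : V ⟶ U} {s' : W ⟶ U} (hs : g ≫ s = s')
    (f : U ⟶ X) (r : V ⟶ X) (r' : W ⟶ X) (hr : s ≫ f = r) (hr' : s' ≫ f = r') (w : g ≫ r = r')
    (b : p.Fiber X) :
    fiberInclusion.map (pullComp p s' f r' hr' b).hom ≫ pullTrans p g r r' w b =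
      pullTrans p g s s' hs ((pull p f).obj b) ≫
        fiberInclusion.map (pullComp p s f r hr b).hom := by
  refine eq_of_comp_eq p g (pullTrans p s f r hr b) ?_
  rw [Category.assoc, Category.assoc, pullComp_hom_trans, pullTrans_proj,
    pullTrans_comp p s f r hr g r' w s' hs, pullComp_hom_trans]

theorem pullComp_inv_trans {W V U X : C} (g : W ⟶ V) {s : V ⟶ U} {s' : W ⟶ U} (hs : g ≫ s = s')
    (f : U ⟶ X) (r : V ⟶ X) (r' : W ⟶ X) (hr : s ≫ f = r) (hr' : s' ≫ f = r') (w : g ≫ r = r')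
    (b : p.Fiber X) :
    fiberInclusion.map (pullComp p s' f r' hr' b).inv ≫
        pullTrans p g s s' hs ((pull p f).obj b) =
      pullTrans p g r r' w b ≫ fiberInclusion.map (pullComp p s f r hr b).inv := by
  have h := pullComp_trans p g hs f r r' hr hr' w b
  rw [← Functor.mapIso_hom, ← Functor.mapIso_hom, ← Iso.eq_inv_comp] at h
  rw [← Functor.mapIso_inv, ← Functor.mapIso_inv, Iso.eq_comp_inv, Category.assoc, h]

theorem res_pullCompIso {W V U U' X : C} (g : W ⟶ V) {s : V ⟶ U} {t : V ⟶ U'} {s' : W ⟶ U}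
    {t' : W ⟶ U'} (hs : g ≫ s = s') (ht : g ≫ t = t') (f : U ⟶ X) (f' : U' ⟶ X) (r : V ⟶ X)
    (r' : W ⟶ X) (hr : s ≫ f = r) (hr' : t ≫ f' = r) (hr₁ : s' ≫ f = r') (hr₁' : t' ≫ f' = r')
    (b : p.Fiber X) :
    res p g s' t' hs ht (pullCompIso p f f' r hr hr' b).hom =
      (pullCompIso p f f' r' hr₁ hr₁' b).hom := by
  have w : g ≫ r = r' := by rw [← hr, ← hr₁, ← hs, Category.assoc]
  apply res_eq
  change fiberInclusion.map (_ ≫ _) ≫ _ = _ ≫ fiberInclusion.map (_ ≫ _)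
  rw [Functor.map_comp, Functor.map_comp, Category.assoc]
  erw [pullComp_inv_trans p g ht f' r r' hr' hr₁' w b]
  rw [reassoc_of% pullComp_trans p g hs f r r' hr hr₁ w b]
  rfl

/-- The left-hand side is the gluing condition on morphisms in `SatisfiesDescent`. -/
theorem res_eq_res_iff {V U U' X : C} {s : V ⟶ U} {t : V ⟶ U'} {f : U ⟶ X} {f' : U' ⟶ X}
    {r : V ⟶ X} (hs : s ≫ f = r) (ht : t ≫ f' = r) {a b : p.Fiber X}
    (φ : (pull p f).obj a ⟶ (pull p f).obj b) (φ' : (pull p f').obj a ⟶ (pull p f').obj b) :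
    res p s r r hs hs φ = res p t r r ht ht φ' ↔
      (pull p s).map φ ≫ (pullCompIso p f f' r hs ht b).hom =
        (pullCompIso p f f' r hs ht a).hom ≫ (pull p t).map φ' := by
  rw [res, res, Iso.inv_comp_eq, pullCompIso, pullCompIso, Iso.trans_hom, Iso.trans_hom,
    Iso.symm_hom, Iso.symm_hom, ← Category.assoc ((pull p s).map φ), Iso.comp_inv_eq]
  simp only [Category.assoc]

/-- The functor from objects over `X` to descent data, given by the restrictions to the `U_i`. -/
def toDescentDatum : p.Fiber X ⥤ DescentDatum 𝒰 p where
  obj b :=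
    { obj i := (pull p (𝒰.f i)).obj b
      iso i j := pullCompIso p (𝒰.f i) (𝒰.f j) (base₂ 𝒰 i j) rfl (snd₂_f 𝒰 i j) b
      cocycle i j k := by
        have h₂ : proj₂ 𝒰 i j k ≫ 𝒰.f j = proj₁ 𝒰 i j k ≫ 𝒰.f i := by
          rw [Category.assoc, Category.assoc, snd₂_f]
        have h₃ : proj₃ 𝒰 i j k ≫ 𝒰.f k = proj₁ 𝒰 i j k ≫ 𝒰.f i := by
          rw [← pullback.condition, Category.assoc]
        rw [res_pullCompIso p _ rfl rfl _ _ _ (proj₁ 𝒰 i j k ≫ 𝒰.f i) _ _ rfl h₂,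
          res_pullCompIso p _ _ _ _ _ _ (proj₁ 𝒰 i j k ≫ 𝒰.f i) _ _ h₂ h₃,
          res_pullCompIso p _ _ _ _ _ _ (proj₁ 𝒰 i j k ≫ 𝒰.f i) _ _ rfl h₃]
        simp [pullCompIso] }
  map {b b'} φ := ⟨fun i => (pull p (𝒰.f i)).map φ, fun i j => by
    rw [← res_eq_res_iff, res_pull_map, res_pull_map]⟩
  map_id b := DescentDatum.hom_ext fun i => (pull p (𝒰.f i)).map_id b
  map_comp φ ψ := DescentDatum.hom_ext fun i => (pull p (𝒰.f i)).map_comp φ ψ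

variable {𝒰 p} in
theorem SatisfiesDescent.existsUnique_map_eq (H : SatisfiesDescent p 𝒰) {a b : p.Fiber X}
    (η : (toDescentDatum 𝒰 p).obj a ⟶ (toDescentDatum 𝒰 p).obj b) :
    ∃! ψ : a ⟶ b, (toDescentDatum 𝒰 p).map ψ = η := by
  simp only [DescentDatum.hom_ext_iff]
  exact H.hom_gluing a b (DescentDatum.app η) fun i j =>
    (res_eq_res_iff p rfl (snd₂_f 𝒰 i j) _ _).2 (DescentDatum.comm η i j)

variable {𝒰 p} in
theorem SatisfiesDescent.isEquivalence (H : SatisfiesDescent p 𝒰) :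
    (toDescentDatum 𝒰 p).IsEquivalence where
  full := ⟨fun η => (H.existsUnique_map_eq η).exists⟩
  faithful := ⟨fun h => (H.existsUnique_map_eq _).unique h rfl⟩
  essSurj := ⟨fun D => by
    obtain ⟨b, β, hβ⟩ := H.obj_gluing D.obj D.iso D.cocycle
    let η : (toDescentDatum 𝒰 p).obj b ⟶ D := ⟨fun i => (β i).hom, fun i j => by
      have := hβ i j
      rw [Category.assoc, Iso.inv_comp_eq] at this
      exact this.trans (Category.assoc _ _ _).symm⟩
    have := DescentDatum.isIso_of_hom η
    exact ⟨b, ⟨asIso η⟩⟩⟩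

theorem satisfiesDescent_of_isEquivalence [(toDescentDatum 𝒰 p).IsEquivalence] :
    SatisfiesDescent p 𝒰 where
  hom_gluing a b φ hφ := by
    let η : (toDescentDatum 𝒰 p).obj a ⟶ (toDescentDatum 𝒰 p).obj b :=
      ⟨φ, fun i j => (res_eq_res_iff p rfl (snd₂_f 𝒰 i j) _ _).1 (hφ i j)⟩
    obtain ⟨ψ, hψ⟩ := (toDescentDatum 𝒰 p).map_surjective η
    refine ⟨ψ, DescentDatum.hom_ext_iff.1 hψ, fun ψ' hψ' => ?_⟩
    exact (toDescentDatum 𝒰 p).map_injective ((DescentDatum.hom_ext hψ').trans hψ.symm)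
  obj_gluing a α cocycle := by
    let D : DescentDatum 𝒰 p := ⟨a, α, cocycle⟩
    let e := (toDescentDatum 𝒰 p).objObjPreimageIso D
    have comp_app {D D' : DescentDatum 𝒰 p} (e : D ≅ D') (i : 𝒰.I₀) :
        DescentDatum.app e.hom i ≫ DescentDatum.app e.inv i = 𝟙 _ :=
      DescentDatum.hom_ext_iff.1 e.hom_inv_id i
    refine ⟨_, fun i => ⟨DescentDatum.app e.hom i, DescentDatum.app e.inv i, comp_app e i,
      comp_app e.symm i⟩, fun i j => ?_⟩
    rw [Category.assoc, Iso.inv_comp_eq]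
    exact (DescentDatum.comm e.hom i j).trans (Category.assoc _ _ _)

theorem satisfiesDescent_iff :
    SatisfiesDescent p 𝒰 ↔ (toDescentDatum 𝒰 p).IsEquivalence :=
  ⟨fun H => H.isEquivalence, fun _ => satisfiesDescent_of_isEquivalence 𝒰 p⟩

end Descent

/-! ### The category of simplices of points of a cover -/

section CechCat

variable {C : Type u} [Category.{v} C] {J : Precoverage C} {X : C}
  (𝒰 : Precoverage.ZeroHypercover.{w} J X)

/-- A point of a cover with values in an object `U` over `X`: a morphism over `X` from `U` to one
of the members of the cover. -/
structure CoverPoint (U : Over X) where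
  idx : 𝒰.I₀
  hom : U.left ⟶ 𝒰.X idx
  w : hom ≫ 𝒰.f idx = U.hom

namespace CoverPoint

variable {𝒰} {U V W : Over X}

/-- The inverse image of a point of a cover under a change of the source. -/
def comap (P : CoverPoint 𝒰 V) (h : U ⟶ V) : CoverPoint 𝒰 U :=
  ⟨P.idx, h.left ≫ P.hom, by rw [Category.assoc, P.w, Over.w h]⟩

theorem comap_id (P : CoverPoint 𝒰 U) : P.comap (𝟙 U) = P := by
  simp [comap]

theorem comap_comp (P : CoverPoint 𝒰 W) (h : U ⟶ V) (h' : V ⟶ W) :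
    P.comap (h ≫ h') = (P.comap h').comap h := by
  simp [comap]

end CoverPoint

/-- An `n`-simplex of points of a cover: `n + 1` points with values in the same object over `X`. -/
structure CechLevel (n : ℕ) where
  base : Over X
  pt : Fin (n + 1) → CoverPoint 𝒰 base

namespace CechLevel

variable {𝒰} {n : ℕ}

/-- A morphism of `n`-simplices: a morphism over `X` under which the points correspond. -/
@[ext]
structure Hom (A B : CechLevel 𝒰 n) where
  base : A.base ⟶ B.base
  pt (k : Fin (n + 1)) : A.pt k = (B.pt k).comap base

instance : Category (CechLevel 𝒰 n) where
  Hom := Hom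
  id A := ⟨𝟙 A.base, fun _ => (CoverPoint.comap_id _).symm⟩
  comp f g := ⟨f.base ≫ g.base, fun k => by rw [f.pt, g.pt, CoverPoint.comap_comp]⟩

theorem hom_ext {A B : CechLevel 𝒰 n} {f g : A ⟶ B} (h : Hom.base f = Hom.base g) : f = g :=
  Hom.ext h

variable (𝒰 n) in
/-- The functor which remembers the source of the points. -/
def forget : CechLevel 𝒰 n ⥤ C where
  obj A := A.base.left
  map f := (Hom.base f).left

/-- The action on simplices of points of a map between the sets of vertices. -/
def reindex {m : ℕ} (σ : Fin (m + 1) → Fin (n + 1)) : CechLevel 𝒰 n ⥤ CechLevel 𝒰 m where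
  obj A := ⟨A.base, fun k => A.pt (σ k)⟩
  map {A B} f := ⟨Hom.base (A := A) (B := B) f, fun k => Hom.pt f (σ k)⟩

end CechLevel

/-- The category of simplices of points of a cover, of all dimensions. -/
structure CechCat where
  deg : SimplexCategory
  level : CechLevel 𝒰 deg.len

namespace CechCat

variable {𝒰}

/-- The object over `X` in which the points of a simplex take their values. -/
abbrev base (A : CechCat 𝒰) : Over X := A.level.base

/-- The points of a simplex. -/
abbrev pt (A : CechCat 𝒰) : Fin (A.deg.len + 1) → CoverPoint 𝒰 A.base := A.level.pt

/-- A morphism of simplices of points: a map of simplices `σ` together with a morphism to the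
restriction of the target along `σ`. -/
structure Hom (A B : CechCat 𝒰) where
  deg : A.deg ⟶ B.deg
  level : A.level ⟶ (CechLevel.reindex deg.toOrderHom).obj B.level

/-- The underlying morphism over `X`. -/
abbrev Hom.base {A B : CechCat 𝒰} (f : Hom A B) : A.base ⟶ B.base := CechLevel.Hom.base f.level

theorem Hom.ext {A B : CechCat 𝒰} {f g : Hom A B} (hdeg : f.deg = g.deg) (hbase : f.base = g.base) :
    f = g := by
  obtain ⟨σ, f⟩ := f
  obtain ⟨σ', g⟩ := g
  obtain rfl : σ = σ' := hdeg
  obtain rfl : f = g := CechLevel.hom_ext hbase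
  rfl

instance : Category (CechCat 𝒰) where
  Hom := Hom
  id A := ⟨𝟙 _, 𝟙 A.level⟩
  comp f g := ⟨f.deg ≫ g.deg, f.level ≫ (CechLevel.reindex f.deg.toOrderHom).map g.level⟩
  id_comp f := Hom.ext (Category.id_comp f.deg) (Category.id_comp f.base)
  comp_id f := Hom.ext (Category.comp_id f.deg) (Category.comp_id f.base)
  assoc f g h :=
    Hom.ext (Category.assoc f.deg g.deg h.deg) (Category.assoc f.base g.base h.base)

theorem hom_ext {A B : CechCat 𝒰} {f g : A ⟶ B} (hdeg : Hom.deg f = Hom.deg g)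
    (hbase : (Hom.base f).left = (Hom.base g).left) : f = g :=
  Hom.ext hdeg (Over.OverMorphism.ext hbase)

variable (𝒰) in
/-- The functor which remembers the object over `X`. -/
def toOver : CechCat 𝒰 ⥤ Over X where
  obj A := A.base
  map f := Hom.base f

variable (𝒰) in
/-- The functor which remembers the source of the points. -/
abbrev forget : CechCat 𝒰 ⥤ C := toOver 𝒰 ⋙ Over.forget X

/-- A point of a cover as a `0`-simplex. -/
abbrev point {U : Over X} (P : CoverPoint 𝒰 U) : CechCat 𝒰 := ⟨⦋0⦌, ⟨U, fun _ => P⟩⟩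

/-- The `1`-simplex with two given vertices. -/
abbrev edge {U : Over X} (P Q : CoverPoint 𝒰 U) : CechCat 𝒰 := ⟨⦋1⦌, ⟨U, ![P, Q]⟩⟩

/-- The `2`-simplex with three given vertices. -/
abbrev triangle {U : Over X} (P Q R : CoverPoint 𝒰 U) : CechCat 𝒰 := ⟨⦋2⦌, ⟨U, ![P, Q, R]⟩⟩

/-- The morphism to a simplex from a point which is the inverse image of a vertex. -/
def ofPoint {U : Over X} {P : CoverPoint 𝒰 U} (A : CechCat 𝒰) (k : Fin (A.deg.len + 1))
    (h : U ⟶ A.base) (e : P = (A.pt k).comap h) : point P ⟶ A :=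
  ⟨SimplexCategory.const ⦋0⦌ A.deg k, h, fun _ => e⟩

theorem ofPoint_comp {U : Over X} {P : CoverPoint 𝒰 U} {A B : CechCat 𝒰} (k : Fin (A.deg.len + 1))
    (h : U ⟶ A.base) (e : P = (A.pt k).comap h) (f : A ⟶ B) (h' : U ⟶ B.base)
    (w : h ≫ Hom.base f = h') :
    ofPoint A k h e ≫ f = ofPoint B ((Hom.deg f).toOrderHom k) h' (by
      rw [e, ← w, CoverPoint.comap_comp]
      exact congrArg (CoverPoint.comap · h) (CechLevel.Hom.pt (Hom.level f) k)) :=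
  hom_ext (SimplexCategory.Hom.ext _ _ (by ext; rfl)) (congrArg CommaMorphism.left w)

/-- The morphism to a simplex from an edge which is the inverse image of an edge of it. -/
def ofEdge {U : Over X} {P Q : CoverPoint 𝒰 U} (A : CechCat 𝒰) {k l : Fin (A.deg.len + 1)}
    (hkl : k ≤ l) (h : U ⟶ A.base) (eP : P = (A.pt k).comap h) (eQ : Q = (A.pt l).comap h) :
    edge P Q ⟶ A :=
  ⟨SimplexCategory.mkOfLe k l hkl, h, Fin.forall_fin_two.2 ⟨eP, eQ⟩⟩

end CechCat

end CechCat

/-! ### Functors on the category of simplices of points -/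

section Edge

variable {C : Type u} [Category.{v} C] {J : Precoverage C} {X : C}
  {𝒰 : Precoverage.ZeroHypercover.{w} J X}
  {E : Type u₂} [Category.{v₂} E] {p : E ⥤ C} (F : FunOver (CechCat.forget 𝒰) p)

open CechCat

variable {U : Over X} {P : CoverPoint 𝒰 U} (A : CechCat 𝒰)

/-- The image under a functor over `C` of the morphism `CechCat.ofPoint`. -/
def mapOfPoint (k : Fin (A.deg.len + 1)) (h : U ⟶ A.base) (e : P = (A.pt k).comap h) :
    F.fn.obj (point P) ⟶ F.fn.obj A :=
  F.fn.map (ofPoint A k h e)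

instance isHomLift_mapOfPoint (k : Fin (A.deg.len + 1)) (h : U ⟶ A.base)
    (e : P = (A.pt k).comap h) : p.IsHomLift h.left (mapOfPoint F A k h e) :=
  F.isHomLift_map (ofPoint A k h e)

theorem mapOfPoint_comp {B : CechCat 𝒰} (k : Fin (A.deg.len + 1)) (h : U ⟶ A.base)
    (e : P = (A.pt k).comap h) (f : A ⟶ B) (l : Fin (B.deg.len + 1))
    (hl : (Hom.deg f).toOrderHom k = l) (h' : U ⟶ B.base) (w : h ≫ Hom.base f = h')
    (e' : P = (B.pt l).comap h') :
    mapOfPoint F A k h e ≫ F.fn.map f = mapOfPoint F B l h' e' := by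
  subst hl
  exact (F.fn.map_comp _ _).symm.trans (congrArg F.fn.map (ofPoint_comp k h e f h' w))

variable (P) (Q : CoverPoint 𝒰 U)

/-- The morphism from the value of a functor over `C` at the source of an edge to its value at the
edge. -/
def mapSource : F.fn.obj (point P) ⟶ F.fn.obj (edge P Q) :=
  mapOfPoint F (edge P Q) 0 (𝟙 U) (CoverPoint.comap_id P).symm

/-- The morphism from the value of a functor over `C` at the target of an edge to its value at the
edge. -/
def mapTarget : F.fn.obj (point Q) ⟶ F.fn.obj (edge P Q) :=
  mapOfPoint F (edge P Q) 1 (𝟙 U) (CoverPoint.comap_id Q).symm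

instance isHomLift_mapSource : p.IsHomLift (𝟙 U.left) (mapSource F P Q) :=
  isHomLift_mapOfPoint F (edge P Q) 0 (𝟙 U) _

instance isHomLift_mapTarget : p.IsHomLift (𝟙 U.left) (mapTarget F P Q) :=
  isHomLift_mapOfPoint F (edge P Q) 1 (𝟙 U) _

variable [IsFiberedInGroupoids p]

instance isIso_mapTarget : IsIso (mapTarget F P Q) :=
  isIso_of_isHomLift_id p (X := U.left) _

end Edge

section EdgeHom

variable {C : Type u} [Category.{v} C] {J : Precoverage C} {X : C}
  {𝒰 : Precoverage.ZeroHypercover.{w} J X}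
  {E : Type u₂} [Category.{v₂} E] {p : E ⥤ C} [IsFiberedInGroupoids p]
  (F : FunOver (CechCat.forget 𝒰) p)

open CechCat

variable {U : Over X} (P Q R : CoverPoint 𝒰 U)

/-- The isomorphism between the values of a functor over `C` at the two vertices of an edge. -/
def edgeHom : F.fn.obj (point P) ⟶ F.fn.obj (point Q) :=
  mapSource F P Q ≫ inv (mapTarget F P Q)

instance isHomLift_edgeHom : p.IsHomLift (𝟙 U.left) (edgeHom F P Q) :=
  inferInstanceAs (p.IsHomLift (𝟙 U.left) (mapSource F P Q ≫ inv (mapTarget F P Q)))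

theorem edgeHom_mapTarget : edgeHom F P Q ≫ mapTarget F P Q = mapSource F P Q := by
  rw [edgeHom, Category.assoc, IsIso.inv_hom_id, Category.comp_id]

variable {P Q} in
theorem edgeHom_mapOfPoint_of_le (A : CechCat 𝒰) {k l : Fin (A.deg.len + 1)} (hkl : k ≤ l)
    (h : U ⟶ A.base) (eP : P = (A.pt k).comap h) (eQ : Q = (A.pt l).comap h) :
    edgeHom F P Q ≫ mapOfPoint F A l h eQ = mapOfPoint F A k h eP := by
  have hP : mapSource F P Q ≫ F.fn.map (ofEdge A hkl h eP eQ) = mapOfPoint F A k h eP :=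
    mapOfPoint_comp F _ _ _ _ _ k rfl h (Category.id_comp h) eP
  have hQ : mapTarget F P Q ≫ F.fn.map (ofEdge A hkl h eP eQ) = mapOfPoint F A l h eQ :=
    mapOfPoint_comp F _ _ _ _ _ l rfl h (Category.id_comp h) eQ
  rw [← hP, ← hQ, reassoc_of% edgeHom_mapTarget F P Q]

theorem edgeHom_comp : edgeHom F P Q ≫ edgeHom F Q R = edgeHom F P R := by
  let T := triangle P Q R
  have hPQ := edgeHom_mapOfPoint_of_le F T (by decide : (0 : Fin 3) ≤ 1) (𝟙 U)
    (CoverPoint.comap_id P).symm (CoverPoint.comap_id Q).symm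
  have hQR := edgeHom_mapOfPoint_of_le F T (by decide : (1 : Fin 3) ≤ 2) (𝟙 U)
    (CoverPoint.comap_id Q).symm (CoverPoint.comap_id R).symm
  have hPR := edgeHom_mapOfPoint_of_le F T (by decide : (0 : Fin 3) ≤ 2) (𝟙 U)
    (CoverPoint.comap_id P).symm (CoverPoint.comap_id R).symm
  refine eq_of_comp_eq p (𝟙 U.left)
    (mapOfPoint F T 2 (𝟙 U) (CoverPoint.comap_id R).symm) ?_
  rw [Category.assoc, hQR, hPQ, hPR]

theorem edgeHom_self : edgeHom F P P = 𝟙 _ := by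
  have := isIso_of_isHomLift_id p (X := U.left) (edgeHom F P P)
  rw [← cancel_epi (edgeHom F P P), edgeHom_comp, Category.comp_id]

variable {P Q} in
theorem edgeHom_mapOfPoint (A : CechCat 𝒰) (k l : Fin (A.deg.len + 1))
    (h : U ⟶ A.base) (eP : P = (A.pt k).comap h) (eQ : Q = (A.pt l).comap h) :
    edgeHom F P Q ≫ mapOfPoint F A l h eQ = mapOfPoint F A k h eP := by
  rcases le_total k l with hkl | hlk
  · exact edgeHom_mapOfPoint_of_le F A hkl h eP eQ
  · rw [← edgeHom_mapOfPoint_of_le F A hlk h eQ eP, ← Category.assoc, edgeHom_comp, edgeHom_self,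
      Category.id_comp]

variable {P Q} in
theorem mapOfPoint_edgeHom {V : Over X} (h : V ⟶ U) {P' Q' : CoverPoint 𝒰 V} (eP : P' = P.comap h)
    (eQ : Q' = Q.comap h) :
    mapOfPoint F (point P) 0 h eP ≫ edgeHom F P Q =
      edgeHom F P' Q' ≫ mapOfPoint F (point Q) 0 h eQ := by
  have hP : mapOfPoint F (point P) 0 h eP ≫ mapSource F P Q =
      mapOfPoint F (edge P Q) 0 h eP :=
    mapOfPoint_comp F _ _ _ _ (ofPoint (edge P Q) 0 (𝟙 U) _) 0 rfl h (Category.comp_id h) eP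
  have hQ : mapOfPoint F (point Q) 0 h eQ ≫ mapTarget F P Q =
      mapOfPoint F (edge P Q) 1 h eQ :=
    mapOfPoint_comp F _ _ _ _ (ofPoint (edge P Q) 1 (𝟙 U) _) 1 rfl h (Category.comp_id h) eQ
  rw [← cancel_mono (mapTarget F P Q), Category.assoc, edgeHom_mapTarget, hP, Category.assoc, hQ]
  exact (edgeHom_mapOfPoint F (edge P Q) 0 1 h eP eQ).symm

end EdgeHom

/-! ### Descent data as functors on the category of simplices of points -/

section OfDescentDatum

variable {C : Type u} [Category.{v} C] {J : Precoverage C} [J.HasPullbacks] {X : C}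
  {𝒰 : Precoverage.ZeroHypercover.{w} J X}
  {E : Type u₂} [Category.{v₂} E] {p : E ⥤ C} [IsFiberedInGroupoids p]

namespace DescentDatum

variable (D : DescentDatum 𝒰 p) {V W Z : C} {i j k : 𝒰.I₀}

/-- The isomorphism between the restrictions to `V` of two members of a descent datum. -/
def cocycleHom (s : V ⟶ 𝒰.X i) (t : V ⟶ 𝒰.X j) (w : s ≫ 𝒰.f i = t ≫ 𝒰.f j) :
    (pull p s).obj (D.obj i) ⟶ (pull p t).obj (D.obj j) :=
  res p (pullback.lift s t w) s t (pullback.lift_fst _ _ _) (pullback.lift_snd _ _ _)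
    (D.iso i j).hom

theorem res_cocycleHom (g : W ⟶ V) (s : V ⟶ 𝒰.X i) (t : V ⟶ 𝒰.X j) (s' : W ⟶ 𝒰.X i)
    (t' : W ⟶ 𝒰.X j) (hs : g ≫ s = s') (ht : g ≫ t = t') (w : s ≫ 𝒰.f i = t ≫ 𝒰.f j)
    (w' : s' ≫ 𝒰.f i = t' ≫ 𝒰.f j) :
    res p g s' t' hs ht (D.cocycleHom s t w) = D.cocycleHom s' t' w' := by
  refine res_res p _ _ _ _ _ g _ _ hs ht _ (pullback.hom_ext ?_ ?_) _
  · rw [Category.assoc, pullback.lift_fst, pullback.lift_fst, hs]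
  · rw [Category.assoc, pullback.lift_snd, pullback.lift_snd, ht]

theorem cocycleHom_fst_snd (i j : 𝒰.I₀) :
    D.cocycleHom (fst₂ 𝒰 i j) (snd₂ 𝒰 i j) pullback.condition = (D.iso i j).hom := by
  have h : pullback.lift (fst₂ 𝒰 i j) (snd₂ 𝒰 i j) pullback.condition = 𝟙 (U₂ 𝒰 i j) := by
    apply pullback.hom_ext
    · rw [pullback.lift_fst, Category.id_comp]
    · rw [pullback.lift_snd, Category.id_comp]
  refine Eq.trans ?_ (res_id p (D.iso i j).hom)
  unfold cocycleHom
  congr 1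

theorem cocycleHom_comp (s : V ⟶ 𝒰.X i) (t : V ⟶ 𝒰.X j) (r : V ⟶ 𝒰.X k)
    (w : s ≫ 𝒰.f i = t ≫ 𝒰.f j) (w' : t ≫ 𝒰.f j = r ≫ 𝒰.f k) :
    D.cocycleHom s t w ≫ D.cocycleHom t r w' = D.cocycleHom s r (w.trans w') := by
  let m : V ⟶ U₃ 𝒰 i j k := pullback.lift (pullback.lift s t w) r (by
    rw [← Category.assoc, pullback.lift_fst, w, w'])
  have h₁₂ : m ≫ proj₁₂ 𝒰 i j k = pullback.lift s t w := pullback.lift_fst _ _ _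
  have h₁ : m ≫ proj₁ 𝒰 i j k = s := by rw [← Category.assoc, h₁₂, pullback.lift_fst]
  have h₂ : m ≫ proj₂ 𝒰 i j k = t := by rw [← Category.assoc, h₁₂, pullback.lift_snd]
  have h₃ : m ≫ proj₃ 𝒰 i j k = r := pullback.lift_snd _ _ _
  have h₂₃ : m ≫ proj₂₃ 𝒰 i j k = pullback.lift t r w' := by
    apply pullback.hom_ext
    · rw [Category.assoc, pullback.lift_fst, pullback.lift_fst, h₂]
    · rw [Category.assoc, pullback.lift_snd, pullback.lift_snd, pullback.lift_snd]
  have h₁₃ : m ≫ proj₁₃ 𝒰 i j k = pullback.lift s r (w.trans w') := by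
    apply pullback.hom_ext
    · rw [Category.assoc, pullback.lift_fst, pullback.lift_fst, h₁]
    · rw [Category.assoc, pullback.lift_snd, pullback.lift_snd, pullback.lift_snd]
  have e := congrArg (res p m s r h₁ h₃) (D.cocycle i j k)
  rw [res_comp p m s t h₁ h₂ r h₃, res_res p _ _ _ _ _ m _ _ h₁ h₂ _ h₁₂,
    res_res p _ _ _ _ _ m _ _ h₂ h₃ _ h₂₃, res_res p _ _ _ _ _ m _ _ h₁ h₃ _ h₁₃] at e
  exact e

theorem cocycleHom_self (s : V ⟶ 𝒰.X i) : D.cocycleHom s s rfl = 𝟙 _ := by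
  rw [← cancel_epi (D.cocycleHom s s rfl), cocycleHom_comp, Category.comp_id]

theorem cocycleHom_naturality {D D' : DescentDatum 𝒰 p} (φ : D ⟶ D') (s : V ⟶ 𝒰.X i)
    (t : V ⟶ 𝒰.X j) (w : s ≫ 𝒰.f i = t ≫ 𝒰.f j) :
    D.cocycleHom s t w ≫ (pull p t).map (app φ j) =
      (pull p s).map (app φ i) ≫ D'.cocycleHom s t w := by
  let l := pullback.lift s t w
  have h₁ : l ≫ fst₂ 𝒰 i j = s := pullback.lift_fst _ _ _
  have h₂ : l ≫ snd₂ 𝒰 i j = t := pullback.lift_snd _ _ _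
  rw [← res_pull_map p l t h₂ (app φ j), ← res_pull_map p l s h₁ (app φ i), cocycleHom, cocycleHom,
    ← res_comp, ← res_comp, comm]

/-- The morphism over `h` from the restriction along `s` to the restriction along `t` which is
given by a descent datum. -/
def transition (s : W ⟶ 𝒰.X i) (t : V ⟶ 𝒰.X j) (h : W ⟶ V) (w : s ≫ 𝒰.f i = (h ≫ t) ≫ 𝒰.f j) :
    fiberInclusion.obj ((pull p s).obj (D.obj i)) ⟶
      fiberInclusion.obj ((pull p t).obj (D.obj j)) :=
  fiberInclusion.map (D.cocycleHom s (h ≫ t) w) ≫ pullTrans p h t (h ≫ t) rfl (D.obj j)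

instance isHomLift_transition (s : W ⟶ 𝒰.X i) (t : V ⟶ 𝒰.X j) (h : W ⟶ V)
    (w : s ≫ 𝒰.f i = (h ≫ t) ≫ 𝒰.f j) : p.IsHomLift h (D.transition s t h w) :=
  isHomLift_comp p (𝟙 W) h h (Category.id_comp h) _ _

theorem transition_eq (s : W ⟶ 𝒰.X i) (t : V ⟶ 𝒰.X j) (h : W ⟶ V) {t' : W ⟶ 𝒰.X j}
    (ht : h ≫ t = t') (w : s ≫ 𝒰.f i = t' ≫ 𝒰.f j) :
    D.transition s t h (by rw [ht, w]) =
      fiberInclusion.map (D.cocycleHom s t' w) ≫ pullTrans p h t t' ht (D.obj j) := by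
  subst ht; rfl

theorem transition_comp (s : W ⟶ 𝒰.X i) (t : V ⟶ 𝒰.X j) (r : Z ⟶ 𝒰.X k) (h : W ⟶ V) (h' : V ⟶ Z)
    (w : s ≫ 𝒰.f i = (h ≫ t) ≫ 𝒰.f j) (w' : t ≫ 𝒰.f j = (h' ≫ r) ≫ 𝒰.f k) :
    D.transition s t h w ≫ D.transition t r h' w' =
      D.transition s r (h ≫ h') (by
        rw [w, Category.assoc, w', ← Category.assoc, ← Category.assoc]) := by
  have w'' : (h ≫ t) ≫ 𝒰.f j = (h ≫ h' ≫ r) ≫ 𝒰.f k := by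
    rw [Category.assoc, w', Category.assoc h]
  rw [D.transition_eq s r (h ≫ h') (Category.assoc _ _ _) (w.trans w''), transition, transition,
    Category.assoc, ← reassoc_of% res_trans p h _ _ rfl rfl (D.cocycleHom t (h' ≫ r) w'),
    D.res_cocycleHom h t _ _ _ rfl rfl w' w'', pullTrans_comp p h' r _ rfl h _ rfl _ rfl,
    ← D.cocycleHom_comp s (h ≫ t) _ w w'',
    Functor.map_comp]
  exact (Category.assoc _ _ _).symm

theorem transition_self (s : W ⟶ 𝒰.X i) (t : V ⟶ 𝒰.X i) (h : W ⟶ V) (ht : h ≫ t = s) :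
    D.transition s t h (by rw [ht]) = pullTrans p h t s ht (D.obj i) := by
  rw [D.transition_eq s t h ht rfl, cocycleHom_self, CategoryTheory.Functor.map_id,
    Category.id_comp]

theorem transition_id (s : V ⟶ 𝒰.X i) (t : V ⟶ 𝒰.X j) (w : s ≫ 𝒰.f i = t ≫ 𝒰.f j) :
    D.transition s t (𝟙 V) (by rw [Category.id_comp, w]) =
      fiberInclusion.map (D.cocycleHom s t w) := by
  rw [D.transition_eq s t _ (Category.id_comp t) w, pullTrans_id, Category.comp_id]

theorem transition_naturality {D D' : DescentDatum 𝒰 p} (φ : D ⟶ D') (s : W ⟶ 𝒰.X i)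
    (t : V ⟶ 𝒰.X j) (h : W ⟶ V) (w : s ≫ 𝒰.f i = (h ≫ t) ≫ 𝒰.f j) :
    D.transition s t h w ≫ fiberInclusion.map ((pull p t).map (app φ j)) =
      fiberInclusion.map ((pull p s).map (app φ i)) ≫ D'.transition s t h w := by
  rw [transition, transition, Category.assoc, ← pull_map_trans, ← Functor.map_comp_assoc,
    cocycleHom_naturality, Functor.map_comp, Category.assoc]

/-- The functor over `C` given by a descent datum; its value at a simplex is the restriction along
the initial vertex. -/
def toFunOverObj : FunOver (CechCat.forget 𝒰) p :=
  FunOver.ofIsHomLift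
    { obj A := fiberInclusion.obj ((pull p (A.pt 0).hom).obj (D.obj (A.pt 0).idx))
      map {A B} f := D.transition (A.pt 0).hom (B.pt 0).hom (CechCat.Hom.base f).left (by
        rw [(A.pt 0).w, Category.assoc, (B.pt 0).w, Over.w])
      map_id A := (D.transition_self _ _ _ (Category.id_comp _)).trans (pullTrans_id p _ _)
      map_comp {A B B'} f g := (D.transition_comp _ _ _ _ _ _ _).symm }
    (fun _ => D.isHomLift_transition _ _ _ _)

/-- The functor from descent data to functors over `C` on the category of simplices of points. -/
def toFunOver : DescentDatum 𝒰 p ⥤ FunOver (CechCat.forget 𝒰) p where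
  obj D := D.toFunOverObj
  map {D D'} φ := FunOver.homMk (F := D.toFunOverObj) (G := D'.toFunOverObj)
    (fun A => fiberInclusion.map ((pull p (A.pt 0).hom).map (app φ (A.pt 0).idx)))
    (fun _ => transition_naturality φ _ _ _ _)
    (fun A => inferInstanceAs (p.IsHomLift (𝟙 A.base.left)
      (fiberInclusion.map ((pull p (A.pt 0).hom).map (app φ (A.pt 0).idx)))))
  map_id D := FunOver.hom_ext fun A =>
    congrArg fiberInclusion.map ((pull p (A.pt 0).hom).map_id (D.obj (A.pt 0).idx))
  map_comp φ ψ := FunOver.hom_ext fun A => congrArg fiberInclusion.map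
    ((pull p (A.pt 0).hom).map_comp (app φ (A.pt 0).idx) (app ψ (A.pt 0).idx))

end DescentDatum

end OfDescentDatum

section FullyFaithful

variable {C : Type u} [Category.{v} C] {J : Precoverage C} {X : C}
  {𝒰 : Precoverage.ZeroHypercover.{w} J X}

namespace CoverPoint

variable (𝒰) in
/-- The tautological point of a cover given by one of its members. -/
def tauto (i : 𝒰.I₀) : CoverPoint 𝒰 (Over.mk (𝒰.f i)) := ⟨i, 𝟙 _, Category.id_comp _⟩

variable {U : Over X} (P : CoverPoint 𝒰 U)

/-- The morphism over `X` underlying a point of a cover. -/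
def overHom : U ⟶ Over.mk (𝒰.f P.idx) := Over.homMk P.hom P.w

theorem eq_comap_tauto : P = (tauto 𝒰 P.idx).comap P.overHom := by
  simp [comap, tauto, overHom]

variable [J.HasPullbacks]

variable (𝒰) in
/-- The first projection from the overlap of two members of a cover. -/
def overlapFst (i j : 𝒰.I₀) : CoverPoint 𝒰 (Over.mk (base₂ 𝒰 i j)) := ⟨i, fst₂ 𝒰 i j, rfl⟩

variable (𝒰) in
/-- The second projection from the overlap of two members of a cover. -/
def overlapSnd (i j : 𝒰.I₀) : CoverPoint 𝒰 (Over.mk (base₂ 𝒰 i j)) :=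
  ⟨j, snd₂ 𝒰 i j, snd₂_f 𝒰 i j⟩

end CoverPoint

variable [J.HasPullbacks] {E : Type u₂} [Category.{v₂} E] {p : E ⥤ C} [IsFiberedInGroupoids p]

namespace DescentDatum

open CechCat

section

variable {D D' : DescentDatum 𝒰 p}

theorem app_eq_app_point (η : D.toFunOverObj ⟶ D'.toFunOverObj) (A : CechCat 𝒰) :
    FunOver.app η A = FunOver.app η (point (A.pt 0)) := by
  let c : point (A.pt 0) ⟶ A := ofPoint A 0 (𝟙 A.base) (CoverPoint.comap_id _).symm
  have map_c (D : DescentDatum 𝒰 p) : D.toFunOverObj.fn.map c = 𝟙 _ :=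
    (D.transition_self _ _ _ (Category.id_comp _)).trans (pullTrans_id p _ _)
  have nat := FunOver.naturality η c
  rw [map_c, map_c] at nat
  exact (Category.id_comp _).symm.trans (nat.trans (Category.comp_id _))

theorem map_app_eq_app_point (η : D.toFunOverObj ⟶ D'.toFunOverObj)
    (φ : ∀ i, D.obj i ⟶ D'.obj i)
    (hφ : ∀ i, fiberInclusion.map ((pull p (𝟙 (𝒰.X i))).map (φ i)) =
      FunOver.app η (point (CoverPoint.tauto 𝒰 i))) {U : Over X} (P : CoverPoint 𝒰 U) :
    fiberInclusion.map ((pull p P.hom).map (φ P.idx)) = FunOver.app η (point P) := by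
  refine pull_map_eq_of_comp_trans p P.hom _ _ (FunOver.isHomLift_app η (point P)) ?_
  let c : point P ⟶ point (CoverPoint.tauto 𝒰 P.idx) := ofPoint _ 0 P.overHom P.eq_comap_tauto
  have map_c (D : DescentDatum 𝒰 p) : D.toFunOverObj.fn.map c =
      pullTrans p P.hom (𝟙 _) P.hom (Category.comp_id _) (D.obj P.idx) :=
    D.transition_self _ _ _ (Category.comp_id _)
  have nat := FunOver.naturality η c
  rw [map_c, map_c] at nat
  rw [hφ]
  exact nat

theorem comm_of_app (η : D.toFunOverObj ⟶ D'.toFunOverObj) (φ : ∀ i, D.obj i ⟶ D'.obj i)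
    (hφ : ∀ {U : Over X} (P : CoverPoint 𝒰 U),
      fiberInclusion.map ((pull p P.hom).map (φ P.idx)) = FunOver.app η (point P)) (i j : 𝒰.I₀) :
    (pull p (fst₂ 𝒰 i j)).map (φ i) ≫ (D'.iso i j).hom =
      (D.iso i j).hom ≫ (pull p (snd₂ 𝒰 i j)).map (φ j) := by
  let P := CoverPoint.overlapFst 𝒰 i j
  let Q := CoverPoint.overlapSnd 𝒰 i j
  let c : point P ⟶ edge Q P := ofPoint (edge Q P) 1 (𝟙 _) (CoverPoint.comap_id P).symm
  have map_c (D : DescentDatum 𝒰 p) :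
      D.toFunOverObj.fn.map c = fiberInclusion.map (D.iso i j).hom :=
    (D.transition_id _ _ pullback.condition).trans
      (congrArg fiberInclusion.map (D.cocycleHom_fst_snd i j))
  have nat := FunOver.naturality η c
  rw [map_c, map_c, app_eq_app_point η (edge Q P)] at nat
  apply Fiber.hom_ext
  rw [Functor.map_comp, Functor.map_comp]
  exact (congrArg (· ≫ _) (hφ P)).trans (nat.symm.trans (congrArg (_ ≫ ·) (hφ Q).symm))

end

instance : (toFunOver : DescentDatum 𝒰 p ⥤ _).Faithful where
  map_injective h := hom_ext fun i => (pull p (𝟙 _)).map_injective (fiberInclusion.map_injective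
    (congrArg (fun η => FunOver.app η (point (CoverPoint.tauto 𝒰 i))) h))

instance : (toFunOver : DescentDatum 𝒰 p ⥤ _).Full where
  map_surjective {D D'} η := by
    choose φ hφ using fun i => (pull p (𝟙 (𝒰.X i))).map_surjective (X := D.obj i) (Y := D'.obj i)
      ⟨FunOver.app η (point (.tauto 𝒰 i)), FunOver.isHomLift_app η (point (.tauto 𝒰 i))⟩
    have hφ' {U : Over X} (P : CoverPoint 𝒰 U) :=
      map_app_eq_app_point η φ (fun i => congrArg fiberInclusion.map (hφ i)) P
    exact ⟨⟨φ, comm_of_app η φ hφ'⟩, FunOver.hom_ext fun A =>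
      (hφ' (A.pt 0)).trans (app_eq_app_point η A).symm⟩

end DescentDatum

end FullyFaithful

section EssSurj

variable {C : Type u} [Category.{v} C] {J : Precoverage C} {X : C}
  {𝒰 : Precoverage.ZeroHypercover.{w} J X}
  {E : Type u₂} [Category.{v₂} E] {p : E ⥤ C} (F : FunOver (CechCat.forget 𝒰) p)

open CechCat

/-- The value of a functor over `C` at the tautological point, as an object of the fiber. -/
def fiberObj (i : 𝒰.I₀) : p.Fiber (𝒰.X i) :=
  ⟨F.fn.obj (point (.tauto 𝒰 i)), F.proj_obj (point (.tauto 𝒰 i))⟩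

variable [IsFiberedInGroupoids p]

section

variable {U : Over X} (P Q R : CoverPoint 𝒰 U)

/-- The morphism from the value of a functor over `C` at a point to its value at the tautological
point. -/
def mapTauto : F.fn.obj (point P) ⟶ fiberInclusion.obj (fiberObj F P.idx) :=
  mapOfPoint F (point (.tauto 𝒰 P.idx)) 0 P.overHom P.eq_comap_tauto

instance isHomLift_mapTauto : p.IsHomLift P.hom (mapTauto F P) :=
  isHomLift_mapOfPoint F (point (.tauto 𝒰 P.idx)) 0 P.overHom P.eq_comap_tauto

/-- The isomorphism from the restriction of the value of a functor over `C` at the tautological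
point to its value at a point. -/
def pullToPoint :
    fiberInclusion.obj ((pull p P.hom).obj (fiberObj F P.idx)) ⟶ F.fn.obj (point P) :=
  factor p (𝟙 U.left) P.hom P.hom (Category.id_comp _) (mapTauto F P) (proj p P.hom _)

instance isHomLift_pullToPoint : p.IsHomLift (𝟙 U.left) (pullToPoint F P) :=
  isHomLift_factor p _ _ _ _ _ _

instance isIso_pullToPoint : IsIso (pullToPoint F P) :=
  isIso_of_isHomLift_id p (X := U.left) _

theorem pullToPoint_mapTauto : pullToPoint F P ≫ mapTauto F P = proj p P.hom _ :=
  factor_comp p _ _ _ _ _ _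

variable {P} in
theorem pullTrans_pullToPoint {V : Over X} (h : V ⟶ U) {s : V.left ⟶ 𝒰.X P.idx}
    (hs : h.left ≫ P.hom = s) (w : s ≫ 𝒰.f P.idx = V.hom) (e : ⟨P.idx, s, w⟩ = P.comap h) :
    pullTrans p h.left P.hom s hs _ ≫ pullToPoint F P =
      pullToPoint F ⟨P.idx, s, w⟩ ≫ mapOfPoint F (point P) 0 h e := by
  let P' : CoverPoint 𝒰 V := ⟨P.idx, s, w⟩
  have hm : mapOfPoint F (point P) 0 h e ≫ mapTauto F P = mapTauto F P' :=
    mapOfPoint_comp F _ _ _ _ (ofPoint (point (.tauto 𝒰 P.idx)) 0 P.overHom P.eq_comap_tauto) 0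
      rfl P'.overHom (Over.OverMorphism.ext hs) P'.eq_comap_tauto
  have := isHomLift_mapOfPoint F (point P) 0 h e
  refine eq_of_comp_eq p h.left (mapTauto F P) ?_ inferInstance
    (isHomLift_comp p (𝟙 V.left) h.left h.left (Category.id_comp _) (pullToPoint F P')
      (mapOfPoint F (point P) 0 h e))
  rw [Category.assoc, Category.assoc, hm, pullToPoint_mapTauto, pullTrans_proj]
  exact (pullToPoint_mapTauto F P').symm

/-- The isomorphism between the restrictions of the values of a functor over `C` at the
tautological points which is given by the two vertices of an edge. -/
def vertexHom : (pull p P.hom).obj (fiberObj F P.idx) ⟶ (pull p Q.hom).obj (fiberObj F Q.idx) :=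
  let φ : fiberInclusion.obj ((pull p P.hom).obj (fiberObj F P.idx)) ⟶
      fiberInclusion.obj ((pull p Q.hom).obj (fiberObj F Q.idx)) :=
    pullToPoint F P ≫ edgeHom F P Q ≫ inv (pullToPoint F Q)
  ⟨φ, isHomLift_comp p (𝟙 U.left) (𝟙 U.left) (𝟙 U.left) (Category.id_comp _) (pullToPoint F P)
    (edgeHom F P Q ≫ CategoryTheory.inv (pullToPoint F Q))⟩

theorem vertexHom_pullToPoint :
    fiberInclusion.map (vertexHom F P Q) ≫ pullToPoint F Q = pullToPoint F P ≫ edgeHom F P Q := by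
  change (_ ≫ _ ≫ _) ≫ _ = _
  rw [Category.assoc, Category.assoc, IsIso.inv_hom_id, Category.comp_id]

theorem vertexHom_comp : vertexHom F P Q ≫ vertexHom F Q R = vertexHom F P R := by
  apply Fiber.hom_ext
  rw [← cancel_mono (pullToPoint F R), Functor.map_comp, Category.assoc, vertexHom_pullToPoint,
    vertexHom_pullToPoint, reassoc_of% vertexHom_pullToPoint F P Q, edgeHom_comp]

theorem vertexHom_self : vertexHom F P P = 𝟙 _ := by
  rw [← cancel_epi (vertexHom F P P), vertexHom_comp, Category.comp_id]

variable {P Q} in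
theorem res_vertexHom {V : Over X} (h : V ⟶ U) {s : V.left ⟶ 𝒰.X P.idx} {t : V.left ⟶ 𝒰.X Q.idx}
    (hs : h.left ≫ P.hom = s) (ht : h.left ≫ Q.hom = t) (w : s ≫ 𝒰.f P.idx = V.hom)
    (w' : t ≫ 𝒰.f Q.idx = V.hom) :
    res p h.left s t hs ht (vertexHom F P Q) = vertexHom F ⟨P.idx, s, w⟩ ⟨Q.idx, t, w'⟩ := by
  have eP : ⟨P.idx, s, w⟩ = P.comap h := by subst hs; rfl
  have eQ : ⟨Q.idx, t, w'⟩ = Q.comap h := by subst ht; rfl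
  apply res_eq
  rw [← cancel_mono (pullToPoint F Q), Category.assoc, Category.assoc, vertexHom_pullToPoint,
    pullTrans_pullToPoint F h ht w' eQ, reassoc_of% vertexHom_pullToPoint F ⟨P.idx, s, w⟩ _,
    ← mapOfPoint_edgeHom F h eP eQ, reassoc_of% pullTrans_pullToPoint F h hs w eP]

end

/-- The comparison of the values of a functor over `C` at a simplex and at its initial vertex. -/
def pullToSimplex (A : CechCat 𝒰) :
    fiberInclusion.obj ((pull p (A.pt 0).hom).obj (fiberObj F (A.pt 0).idx)) ⟶ F.fn.obj A :=
  pullToPoint F (A.pt 0) ≫ mapOfPoint F A 0 (𝟙 A.base) (CoverPoint.comap_id _).symm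

instance isHomLift_pullToSimplex (A : CechCat 𝒰) :
    p.IsHomLift (𝟙 A.base.left) (pullToSimplex F A) :=
  have := isHomLift_mapOfPoint F A 0 (𝟙 A.base) (CoverPoint.comap_id _).symm
  isHomLift_comp p (𝟙 A.base.left) (𝟙 A.base.left) _ (Category.id_comp _) (pullToPoint F (A.pt 0))
    (mapOfPoint F A 0 (𝟙 A.base) (CoverPoint.comap_id _).symm)

theorem pullTrans_pullToSimplex {U : Over X} (B : CechCat 𝒰) (h : U ⟶ B.base) :
    pullTrans p h.left (B.pt 0).hom (h.left ≫ (B.pt 0).hom) rfl (fiberObj F (B.pt 0).idx) ≫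
        pullToSimplex F B =
      pullToPoint F ((B.pt 0).comap h) ≫ mapOfPoint F B 0 h rfl := by
  have hB : mapOfPoint F (point (B.pt 0)) 0 h rfl ≫
      mapOfPoint F B 0 (𝟙 B.base) (CoverPoint.comap_id _).symm = mapOfPoint F B 0 h rfl :=
    mapOfPoint_comp F (point (B.pt 0)) 0 h rfl
      (ofPoint B 0 (𝟙 B.base) (CoverPoint.comap_id _).symm) 0 rfl h (Category.comp_id _) rfl
  rw [← hB, pullToSimplex]
  exact ((Category.assoc _ _ _).symm.trans (congrArg (· ≫ _)
    (pullTrans_pullToPoint F h rfl ((B.pt 0).comap h).w rfl))).trans (Category.assoc _ _ _)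

variable [J.HasPullbacks]

theorem res_vertexHom_overlap {U : Over X} (P Q : CoverPoint 𝒰 U)
    (m : U.left ⟶ U₂ 𝒰 P.idx Q.idx) (h₁ : m ≫ fst₂ 𝒰 P.idx Q.idx = P.hom)
    (h₂ : m ≫ snd₂ 𝒰 P.idx Q.idx = Q.hom) :
    res p m P.hom Q.hom h₁ h₂ (vertexHom F (.overlapFst 𝒰 P.idx Q.idx)
      (.overlapSnd 𝒰 P.idx Q.idx)) = vertexHom F P Q := by
  have w : m ≫ base₂ 𝒰 P.idx Q.idx = U.hom := by rw [← Category.assoc, h₁, P.w]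
  exact res_vertexHom F (P := .overlapFst 𝒰 P.idx Q.idx) (Q := .overlapSnd 𝒰 P.idx Q.idx)
    (Over.homMk m w) h₁ h₂ P.w Q.w

namespace FunOver

/-- The descent datum of a functor over `C` on the category of simplices of points. -/
def descentDatum : DescentDatum 𝒰 p where
  obj i := fiberObj F i
  iso i j :=
    let P := CoverPoint.overlapFst 𝒰 i j
    let Q := CoverPoint.overlapSnd 𝒰 i j
    ⟨vertexHom F P Q, vertexHom F Q P, (vertexHom_comp F P Q P).trans (vertexHom_self F P),
      (vertexHom_comp F Q P Q).trans (vertexHom_self F Q)⟩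
  cocycle i j k := by
    have h₂ : proj₂ 𝒰 i j k ≫ 𝒰.f j = proj₁ 𝒰 i j k ≫ 𝒰.f i := by
      rw [Category.assoc, Category.assoc, snd₂_f]
    have h₃ : proj₃ 𝒰 i j k ≫ 𝒰.f k = proj₁ 𝒰 i j k ≫ 𝒰.f i := by
      rw [← pullback.condition, Category.assoc]
    let U : Over X := Over.mk (proj₁ 𝒰 i j k ≫ 𝒰.f i)
    let P : CoverPoint 𝒰 U := ⟨i, proj₁ 𝒰 i j k, rfl⟩
    let Q : CoverPoint 𝒰 U := ⟨j, proj₂ 𝒰 i j k, h₂⟩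
    let R : CoverPoint 𝒰 U := ⟨k, proj₃ 𝒰 i j k, h₃⟩
    have hPQ := res_vertexHom_overlap F P Q (proj₁₂ 𝒰 i j k) rfl rfl
    have hQR := res_vertexHom_overlap F Q R (proj₂₃ 𝒰 i j k) (pullback.lift_fst _ _ _)
      (pullback.lift_snd _ _ _)
    have hPR := res_vertexHom_overlap F P R (proj₁₃ 𝒰 i j k) (pullback.lift_fst _ _ _)
      (pullback.lift_snd _ _ _)
    exact (congrArg₂ (· ≫ ·) hPQ hQR).trans ((vertexHom_comp F P Q R).trans hPR.symm)

theorem cocycleHom_descentDatum {U : Over X} (P Q : CoverPoint 𝒰 U) :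
    (descentDatum F).cocycleHom P.hom Q.hom (P.w.trans Q.w.symm) = vertexHom F P Q :=
  res_vertexHom_overlap F P Q _ (pullback.lift_fst _ _ _) (pullback.lift_snd _ _ _)

end FunOver

theorem pullToSimplex_naturality {A B : CechCat 𝒰} (f : A ⟶ B) :
    (FunOver.descentDatum F).toFunOverObj.fn.map f ≫ pullToSimplex F B =
      pullToSimplex F A ≫ F.fn.map f := by
  let h : A.base ⟶ B.base := Hom.base f
  let P := A.pt 0
  let Q := (B.pt 0).comap h
  let l := (Hom.deg f).toOrderHom 0
  have eP : P = (B.pt l).comap h := CechLevel.Hom.pt (Hom.level f) 0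
  have map_f : (FunOver.descentDatum F).toFunOverObj.fn.map f =
      fiberInclusion.map (vertexHom F P Q) ≫
        pullTrans p h.left (B.pt 0).hom Q.hom rfl (fiberObj F Q.idx) :=
    (DescentDatum.transition_eq _ P.hom (B.pt 0).hom h.left rfl (P.w.trans Q.w.symm)).trans
      (congrArg (fun φ => fiberInclusion.map φ ≫ _) (FunOver.cocycleHom_descentDatum F P Q))
  have map_source : mapOfPoint F A 0 (𝟙 A.base) (CoverPoint.comap_id _).symm ≫ F.fn.map f =
      mapOfPoint F B l h eP :=
    mapOfPoint_comp F _ _ _ _ f l rfl _ (Category.id_comp _) _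
  refine (congrArg (· ≫ _) map_f).trans ((Category.assoc _ _ _).trans
    ((congrArg (_ ≫ ·) (pullTrans_pullToSimplex F B h)).trans ?_))
  change fiberInclusion.map (vertexHom F P Q) ≫ pullToPoint F Q ≫ mapOfPoint F B 0 h rfl = _
  rw [reassoc_of% vertexHom_pullToPoint F P Q, edgeHom_mapOfPoint F B l 0 h eP rfl, ← map_source,
    pullToSimplex, Category.assoc]

namespace DescentDatum

instance : (toFunOver : DescentDatum 𝒰 p ⥤ _).EssSurj where
  mem_essImage F := by
    let η : toFunOver.obj (FunOver.descentDatum F) ⟶ F :=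
      FunOver.homMk (F := (FunOver.descentDatum F).toFunOverObj) (G := F) (pullToSimplex F)
        (pullToSimplex_naturality F) (isHomLift_pullToSimplex F)
    have := FunOver.isIso_of_hom η
    exact ⟨_, ⟨asIso η⟩⟩

instance : (toFunOver : DescentDatum 𝒰 p ⥤ _).IsEquivalence where

end DescentDatum

end EssSurj

/-! ### Descent as restriction to the category of simplices of points -/

section Pre

variable {C : Type u} [Category.{v} C] {E : Type u₂} [Category.{v₂} E] (p : E ⥤ C)
  {D : Type*} [Category* D] {D' : Type*} [Category* D'] {π : D ⥤ C} {π' : D' ⥤ C}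

/-- Precomposition with a functor over `C`. -/
def FunOver.pre (H : FunOver π' π) : FunOver π p ⥤ FunOver π' p where
  obj F := BasedFunctor.comp H F
  map φ := BasedCategory.whiskerLeft H φ

end Pre

section SatisfiesDescent

variable {C : Type u} [Category.{v} C] {J : Precoverage C} {X : C}
  (𝒰 : Precoverage.ZeroHypercover.{w} J X)
  {E : Type u₂} [Category.{v₂} E] (p : E ⥤ C)

/-- The restriction of a section over `X` to the category of simplices of points. -/
def restrictCech : FunOver (Over.forget X) p ⥤ FunOver (CechCat.forget 𝒰) p :=
  FunOver.pre p
    { toFunctor := CechCat.toOver 𝒰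
      w := rfl }

variable [J.HasPullbacks] [IsFiberedInGroupoids p]

theorem cocycleHom_toDescentDatum_pullComp (b : p.Fiber X) {V : C} {i j : 𝒰.I₀} (s : V ⟶ 𝒰.X i)
    (t : V ⟶ 𝒰.X j) (r : V ⟶ X) (hs : s ≫ 𝒰.f i = r) (ht : t ≫ 𝒰.f j = r) :
    ((toDescentDatum 𝒰 p).obj b).cocycleHom s t (hs.trans ht.symm) ≫
        (pullComp p t (𝒰.f j) r ht b).hom =
      (pullComp p s (𝒰.f i) r hs b).hom := by
  have h : ((toDescentDatum 𝒰 p).obj b).cocycleHom s t (hs.trans ht.symm) =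
      (pullCompIso p (𝒰.f i) (𝒰.f j) r hs ht b).hom := res_pullCompIso p _ _ _ _ _ _ _ _ _ _ _ _
  exact (Iso.eq_comp_inv _).1 h

theorem transition_toDescentDatum_pullComp (b : p.Fiber X) {W V : C} {i j : 𝒰.I₀} (s : W ⟶ 𝒰.X i)
    (t : V ⟶ 𝒰.X j) (h : W ⟶ V) (r : W ⟶ X) (r' : V ⟶ X) (hs : s ≫ 𝒰.f i = r)
    (ht : t ≫ 𝒰.f j = r') (w : h ≫ r' = r) :
    ((toDescentDatum 𝒰 p).obj b).transition s t h (by rw [hs, Category.assoc, ht, w]) ≫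
        fiberInclusion.map (pullComp p t (𝒰.f j) r' ht b).hom =
      fiberInclusion.map (pullComp p s (𝒰.f i) r hs b).hom ≫ pullTrans p h r' r w b := by
  have ht' : (h ≫ t) ≫ 𝒰.f j = r := by rw [Category.assoc, ht, w]
  rw [DescentDatum.transition, Category.assoc]
  refine (congrArg (_ ≫ ·) (pullComp_trans p h rfl (𝒰.f j) r' r ht ht' w b).symm).trans ?_
  refine (Category.assoc _ _ _).symm.trans (congrArg (· ≫ _) ?_)
  exact (Functor.map_comp _ _ _).symm.trans (congrArg fiberInclusion.map
    (cocycleHom_toDescentDatum_pullComp 𝒰 p b s (h ≫ t) r hs ht'))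

theorem pullComp_naturality {V U X : C} (s : V ⟶ U) (f : U ⟶ X) (r : V ⟶ X) (w : s ≫ f = r)
    {b b' : p.Fiber X} (φ : b ⟶ b') :
    (pull p s).map ((pull p f).map φ) ≫ (pullComp p s f r w b').hom =
      (pullComp p s f r w b).hom ≫ (pull p r).map φ := by
  rw [← Iso.inv_comp_eq]
  exact res_pull_map p s r w φ

/-- The canonical isomorphism from the functor given by the descent datum of an object over `X` to
the restriction of its chosen pullbacks. -/
def toFunOverToDescentDatumIso (b : p.Fiber X) :
    DescentDatum.toFunOver.obj ((toDescentDatum 𝒰 p).obj b) ≅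
      (restrictCech 𝒰 p).obj ((twoYoneda p X).obj b) :=
  let η : DescentDatum.toFunOver.obj ((toDescentDatum 𝒰 p).obj b) ⟶
      (restrictCech 𝒰 p).obj ((twoYoneda p X).obj b) :=
    FunOver.homMk
      (fun A => fiberInclusion.map
        (pullComp p (A.pt 0).hom (𝒰.f (A.pt 0).idx) A.base.hom (A.pt 0).w b).hom)
      (fun _ => transition_toDescentDatum_pullComp 𝒰 p b _ _ _ _ _ _ _ (Over.w _))
      (fun A => inferInstanceAs (p.IsHomLift (𝟙 A.base.left) (fiberInclusion.map
        (pullComp p (A.pt 0).hom (𝒰.f (A.pt 0).idx) A.base.hom (A.pt 0).w b).hom)))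
  have := FunOver.isIso_of_hom η
  asIso η

/-- The functors on the category of simplices of points given by the descent data of the objects
over `X` are the restrictions of the sections over `X`. -/
def toDescentDatumCompToFunOverIso :
    toDescentDatum 𝒰 p ⋙ DescentDatum.toFunOver ≅ twoYoneda p X ⋙ restrictCech 𝒰 p :=
  NatIso.ofComponents (toFunOverToDescentDatumIso 𝒰 p) fun φ => FunOver.hom_ext fun A => by
    have h := congrArg fiberInclusion.map (pullComp_naturality p
      (A.pt 0).hom (𝒰.f (A.pt 0).idx) A.base.hom (A.pt 0).w φ)
    exact (Functor.map_comp _ _ _).symm.trans (h.trans (Functor.map_comp _ _ _))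

theorem satisfiesDescent_iff_restrictCech :
    SatisfiesDescent p 𝒰 ↔ (restrictCech 𝒰 p).IsEquivalence := by
  rw [satisfiesDescent_iff]
  have e := toDescentDatumCompToFunOverIso 𝒰 p
  constructor
  · intro
    have := isEquivalence_of_iso e
    exact isEquivalence_of_comp_left (twoYoneda p X) (restrictCech 𝒰 p)
  · intro
    have := isEquivalence_of_iso e.symm
    exact isEquivalence_of_comp_right (toDescentDatum 𝒰 p) DescentDatum.toFunOver

end SatisfiesDescent

/-! ### Homotopy limits and pseudocones -/

section PseudoCone

variable {I : Type u₁} [Category.{v₁} I] (X : I ⥤ Grpd.{v, u})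

/-- The values of a diagram of groupoids. -/
def Val (i : I) : Type u := X.obj i

instance (i : I) : Groupoid.{v} (Val X i) := inferInstanceAs (Groupoid (X.obj i))

/-- The functor between the values of a diagram of groupoids. -/
def act {j i : I} (σ : j ⟶ i) : Val X j ⥤ Val X i := X.map σ

theorem act_id (i : I) : act X (𝟙 i) = 𝟭 _ := X.map_id i

theorem act_comp {k j i : I} (σ : k ⟶ j) (τ : j ⟶ i) :
    act X (σ ≫ τ) = act X σ ⋙ act X τ := X.map_comp σ τ

theorem act_id_obj (i : I) (x : Val X i) : (act X (𝟙 i)).obj x = x :=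
  Functor.congr_obj (act_id X i) x

theorem act_comp_obj {k j i : I} (σ : k ⟶ j) (τ : j ⟶ i) (x : Val X k) :
    (act X (σ ≫ τ)).obj x = (act X τ).obj ((act X σ).obj x) :=
  Functor.congr_obj (act_comp X σ τ) x

theorem act_id_map (i : I) {x y : Val X i} (f : x ⟶ y) :
    (act X (𝟙 i)).map f = eqToHom (act_id_obj X i x) ≫ f ≫ eqToHom (act_id_obj X i y).symm :=
  Functor.congr_hom (act_id X i) f

theorem act_comp_map {k j i : I} (σ : k ⟶ j) (τ : j ⟶ i) {x y : Val X k} (f : x ⟶ y) :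
    (act X (σ ≫ τ)).map f = eqToHom (act_comp_obj X σ τ x) ≫ (act X τ).map ((act X σ).map f) ≫
      eqToHom (act_comp_obj X σ τ y).symm :=
  Functor.congr_hom (act_comp X σ τ) f

/-- A pseudocone on a diagram of groupoids. -/
structure PseudoCone where
  pt : ∀ i, Val X i
  tr : ∀ {j i : I} (σ : j ⟶ i), (act X σ).obj (pt j) ⟶ pt i
  tr_id : ∀ i, tr (𝟙 i) = eqToHom (act_id_obj X i (pt i))
  tr_comp : ∀ {k j i : I} (σ : k ⟶ j) (τ : j ⟶ i),
    tr (σ ≫ τ) = eqToHom (act_comp_obj X σ τ (pt k)) ≫ (act X τ).map (tr σ) ≫ tr τ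

namespace PseudoCone

variable {X}

/-- A morphism of pseudocones. -/
@[ext]
structure Hom (c d : PseudoCone X) where
  app : ∀ i, c.pt i ⟶ d.pt i
  comm : ∀ {j i : I} (σ : j ⟶ i), (act X σ).map (app j) ≫ d.tr σ = c.tr σ ≫ app i

instance : Category (PseudoCone X) where
  Hom := Hom
  id c := ⟨fun i => 𝟙 _, fun σ => by
    rw [CategoryTheory.Functor.map_id, Category.id_comp, Category.comp_id]⟩
  comp f g := ⟨fun i => f.app i ≫ g.app i, fun σ => by
    rw [CategoryTheory.Functor.map_comp, Category.assoc, g.comm, reassoc_of% f.comm σ]⟩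
  id_comp f := Hom.ext (funext fun i => Category.id_comp _)
  comp_id f := Hom.ext (funext fun i => Category.comp_id _)
  assoc f g h := Hom.ext (funext fun i => Category.assoc _ _ _)

theorem isIso_of_hom {c d : PseudoCone X} (f : c ⟶ d) : IsIso f := by
  refine ⟨⟨⟨fun i => inv (Hom.app f i), fun {j i} σ => ?_⟩, ?_, ?_⟩⟩
  · rw [CategoryTheory.Functor.map_inv, IsIso.inv_comp_eq, ← Category.assoc, IsIso.eq_comp_inv]
    exact (Hom.comm f σ).symm
  · exact Hom.ext (funext fun i => IsIso.hom_inv_id _)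
  · exact Hom.ext (funext fun i => IsIso.inv_hom_id _)

end PseudoCone

variable {X}

/-- The functors on the slices of the index category underlying an object of the
homotopy limit. -/
def sliceFunctor (A : HoLim X) (i : I) : Over i ⥤ Val X i := FreeGroupoid.of _ ⋙ A.obj i

theorem sliceFunctor_map (A : HoLim X) {j i : I} (σ : j ⟶ i) :
    Over.map σ ⋙ sliceFunctor A i = sliceFunctor A j ⋙ act X σ :=
  congrArg (FreeGroupoid.of _ ⋙ ·) (congrFun A.eq (Arrow.mk σ))

/-- The point of an object of the homotopy limit at an index. -/
abbrev holimPt (A : HoLim X) (i : I) : Val X i := (sliceFunctor A i).obj (Over.mk (𝟙 i))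

theorem sliceFunctor_obj (A : HoLim X) {j i : I} (σ : j ⟶ i) :
    (sliceFunctor A i).obj (Over.mk σ) = (act X σ).obj (holimPt A j) := by
  have h := Functor.congr_obj (sliceFunctor_map A σ) (Over.mk (𝟙 j))
  refine Eq.trans ?_ h
  exact congrArg (fun τ : j ⟶ i => (sliceFunctor A i).obj (Over.mk τ)) (Category.id_comp σ).symm

/-- The transition morphisms of an object of the homotopy limit. -/
def holimTr (A : HoLim X) {j i : I} (σ : j ⟶ i) : (act X σ).obj (holimPt A j) ⟶ holimPt A i :=
  eqToHom (sliceFunctor_obj A σ).symm ≫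
    (sliceFunctor A i).map (Over.homMk σ : Over.mk σ ⟶ Over.mk (𝟙 i))

theorem sliceFunctor_map_homMk_congr (A : HoLim X) {k j i : I} (σ : k ⟶ j) (τ τ' : j ⟶ i)
    (e : τ = τ') (ρ : k ⟶ i) (w : σ ≫ τ = ρ) :
    (sliceFunctor A i).map (Over.homMk σ w : Over.mk ρ ⟶ Over.mk τ) =
      (sliceFunctor A i).map (Over.homMk σ (e ▸ w) : Over.mk ρ ⟶ Over.mk τ') ≫
        eqToHom (by rw [e]) := by
  subst e
  simp

theorem sliceFunctor_map_homMk (A : HoLim X) {k j i : I} (σ : k ⟶ j) (τ : j ⟶ i) :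
    (sliceFunctor A i).map (Over.homMk σ rfl : Over.mk (σ ≫ τ) ⟶ Over.mk τ) =
      eqToHom ((sliceFunctor_obj A (σ ≫ τ)).trans (act_comp_obj X σ τ _)) ≫
        (act X τ).map (holimTr A σ) ≫ eqToHom (sliceFunctor_obj A τ).symm := by
  have h := Functor.congr_hom (sliceFunctor_map A τ)
    (Over.homMk σ : Over.mk σ ⟶ Over.mk (𝟙 j))
  rw [sliceFunctor_map_homMk_congr A σ τ (𝟙 j ≫ τ) (Category.id_comp τ).symm (σ ≫ τ) rfl]
  refine (congrArg (· ≫ eqToHom _) h).trans ?_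
  simp only [holimTr, CategoryTheory.Functor.map_comp, eqToHom_map, Category.assoc, eqToHom_trans,
    eqToHom_trans_assoc, CategoryTheory.Functor.comp_map]

/-- The pseudocone of an object of the homotopy limit. -/
def holimCone (A : HoLim X) : PseudoCone X where
  pt := holimPt A
  tr σ := holimTr A σ
  tr_id i := by
    have h : (Over.homMk (𝟙 i) : Over.mk (𝟙 i) ⟶ Over.mk (𝟙 i)) = 𝟙 _ := rfl
    unfold holimTr
    rw [h, CategoryTheory.Functor.map_id, Category.comp_id]
  tr_comp {k j i} σ τ := by
    have h : (Over.homMk (σ ≫ τ) : Over.mk (σ ≫ τ) ⟶ Over.mk (𝟙 i)) =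
      (Over.homMk σ rfl : Over.mk (σ ≫ τ) ⟶ Over.mk τ) ≫
        (Over.homMk τ : Over.mk τ ⟶ Over.mk (𝟙 i)) := rfl
    have h' := congrArg (sliceFunctor A i).map h
    rw [CategoryTheory.Functor.map_comp, sliceFunctor_map_homMk] at h'
    refine (congrArg (eqToHom _ ≫ ·) h').trans ?_
    simp only [Category.assoc, eqToHom_trans_assoc]
    rfl

/-- The natural transformations on the slices of the index category underlying a morphism of
the homotopy limit. -/
def sliceHom {A B : HoLim X} (φ : A ⟶ B) (i : I) : sliceFunctor A i ⟶ sliceFunctor B i :=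
  Functor.whiskerLeft (FreeGroupoid.of _) (φ.hom i)

theorem holim_hom_ext {A B : HoLim X} {φ ψ : A ⟶ B}
    (h : ∀ {j i : I} (σ : j ⟶ i),
      (sliceHom φ i).app (Over.mk σ) = (sliceHom ψ i).app (Over.mk σ)) : φ = ψ := by
  refine StrictEqualizer.Hom.ext (funext fun i => NatTrans.ext (funext fun f => ?_))
  exact h f.as.as.hom

theorem sliceHom_map {A B : HoLim X} (φ : A ⟶ B) {j i : I} (σ : j ⟶ i) (f : Over j) :
    (sliceHom φ i).app ((Over.map σ).obj f) =
      eqToHom (Functor.congr_obj (sliceFunctor_map A σ) f) ≫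
        (act X σ).map ((sliceHom φ j).app f) ≫
          eqToHom (Functor.congr_obj (sliceFunctor_map B σ) f).symm := by
  have h := NatTrans.congr_app (congrFun φ.eq (Arrow.mk σ)) (FreeGroupoid.mk f)
  simp only [Pi.comp_apply, CategoryTheory.Functor.eqToHom_proj, NatTrans.comp_app,
    eqToHom_app] at h
  exact h

theorem sliceHom_app {A B : HoLim X} (φ : A ⟶ B) {j i : I} (σ : j ⟶ i) :
    (sliceHom φ i).app (Over.mk σ) =
      eqToHom (sliceFunctor_obj A σ) ≫ (act X σ).map ((sliceHom φ j).app (Over.mk (𝟙 j))) ≫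
        eqToHom (sliceFunctor_obj B σ).symm := by
  have h : (sliceHom φ i).app (Over.mk (𝟙 j ≫ σ)) = _ := sliceHom_map φ σ (Over.mk (𝟙 j))
  have e (τ : j ⟶ i) (hτ : σ = τ) : (sliceHom φ i).app (Over.mk σ) =
      eqToHom (by rw [hτ]) ≫ (sliceHom φ i).app (Over.mk τ) ≫ eqToHom (by rw [hτ]) := by
    subst hτ; simp
  refine (e _ (Category.id_comp σ).symm).trans ?_
  rw [h]
  simp only [Category.assoc, eqToHom_trans, eqToHom_trans_assoc]

/-- The functor from the homotopy limit to pseudocones. -/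
def holimToCone (X : I ⥤ Grpd.{v, u}) : HoLim X ⥤ PseudoCone X where
  obj A := holimCone A
  map {A B} φ :=
    { app := fun i => (sliceHom φ i).app (Over.mk (𝟙 i))
      comm := fun {j i} σ => by
        have h := (sliceHom φ i).naturality (Over.homMk σ : Over.mk σ ⟶ Over.mk (𝟙 i))
        rw [sliceHom_app φ σ] at h
        change (act X σ).map ((sliceHom φ j).app (Over.mk (𝟙 j))) ≫ eqToHom _ ≫
          (sliceFunctor B i).map _ = (eqToHom _ ≫ (sliceFunctor A i).map _) ≫ _
        rw [Category.assoc, h]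
        simp only [Category.assoc, eqToHom_trans_assoc, eqToHom_refl, Category.id_comp] }
  map_id A := rfl
  map_comp φ ψ := rfl

instance : (holimToCone X).Faithful where
  map_injective {A B φ ψ} h := holim_hom_ext fun {j i} σ => by
    have hj : (sliceHom φ j).app (Over.mk (𝟙 j)) = (sliceHom ψ j).app (Over.mk (𝟙 j)) :=
      congrArg (fun f => PseudoCone.Hom.app f j) h
    rw [sliceHom_app φ σ, sliceHom_app ψ σ, hj]

section Lift

variable {A B : HoLim X} (f : holimCone A ⟶ holimCone B)

/-- The component of a morphism of pseudocones, as a morphism between points of objects of the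
homotopy limit. -/
def ptHom (i : I) : holimPt A i ⟶ holimPt B i := PseudoCone.Hom.app f i

theorem ptHom_comm {j i : I} (σ : j ⟶ i) :
    (act X σ).map (ptHom f j) ≫ holimTr B σ = holimTr A σ ≫ ptHom f i := PseudoCone.Hom.comm f σ

/-- The components on the slices of a morphism of pseudocones. -/
def coneApp {j i : I} (σ : j ⟶ i) :
    (sliceFunctor A i).obj (Over.mk σ) ⟶ (sliceFunctor B i).obj (Over.mk σ) :=
  eqToHom (sliceFunctor_obj A σ) ≫ (act X σ).map (ptHom f j) ≫ eqToHom (sliceFunctor_obj B σ).symm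

theorem coneApp_comp {k j i : I} (σ : k ⟶ j) (τ : j ⟶ i) :
    coneApp f (σ ≫ τ) =
      eqToHom (Functor.congr_obj (sliceFunctor_map A τ) (Over.mk σ)) ≫
        (act X τ).map (coneApp f σ) ≫
          eqToHom (Functor.congr_obj (sliceFunctor_map B τ) (Over.mk σ)).symm := by
  simp only [coneApp, act_comp_map, CategoryTheory.Functor.map_comp, eqToHom_map, Category.assoc,
    eqToHom_trans, eqToHom_trans_assoc]

theorem coneApp_id (i : I) : coneApp f (𝟙 i) = ptHom f i := by
  simp only [coneApp, act_id_map, Category.assoc, eqToHom_trans, eqToHom_trans_assoc,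
    eqToHom_refl, Category.id_comp, Category.comp_id]

theorem coneApp_naturality {k j i : I} (σ : k ⟶ j) (τ : j ⟶ i) (ρ : k ⟶ i) (w : σ ≫ τ = ρ) :
    (sliceFunctor A i).map (Over.homMk σ w : Over.mk ρ ⟶ Over.mk τ) ≫ coneApp f τ =
      coneApp f ρ ≫ (sliceFunctor B i).map (Over.homMk σ w : Over.mk ρ ⟶ Over.mk τ) := by
  subst w
  have h := congrArg (act X τ).map (ptHom_comm f σ)
  rw [CategoryTheory.Functor.map_comp, CategoryTheory.Functor.map_comp] at h
  simp only [sliceFunctor_map_homMk, coneApp, act_comp_map, Category.assoc, eqToHom_trans_assoc,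
    eqToHom_refl, Category.id_comp, reassoc_of% h]

/-- The natural isomorphisms on the slices of a morphism of pseudocones. -/
def coneSliceIso (i : I) : sliceFunctor A i ≅ sliceFunctor B i :=
  NatIso.ofComponents (fun g => asIso (coneApp f g.hom))
    (fun {g g'} h => coneApp_naturality f h.left g'.hom g.hom (Over.w h))

/-- The morphism of the homotopy limit induced by a morphism of pseudocones. -/
def holimHomMk : A ⟶ B where
  hom i := (FreeGroupoid.liftNatIso (A.obj i) (B.obj i) (coneSliceIso f i)).hom
  eq := by
    funext α
    refine NatTrans.ext (funext fun g => ?_)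
    simp only [Pi.comp_apply, CategoryTheory.Functor.eqToHom_proj, NatTrans.comp_app, eqToHom_app]
    have h₁ := FreeGroupoid.liftNatIso_hom_app (A.obj α.right) (B.obj α.right)
      (coneSliceIso f α.right) ((Over.map α.hom).obj g.as.as)
    have h₂ := FreeGroupoid.liftNatIso_hom_app (A.obj α.left) (B.obj α.left)
      (coneSliceIso f α.left) g.as.as
    have h₃ := congrArg (X.map α.hom : X.obj α.left ⥤ X.obj α.right).map h₂
    refine h₁.trans ((coneApp_comp f g.as.as.hom α.hom).trans ?_)
    exact congrArg (fun z => eqToHom _ ≫ z ≫ eqToHom _) h₃.symm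

theorem holimToCone_map_holimHomMk : (holimToCone X).map (holimHomMk f) = f :=
  PseudoCone.Hom.ext (funext fun i => (FreeGroupoid.liftNatIso_hom_app (A.obj i) (B.obj i)
    (coneSliceIso f i) _).trans (coneApp_id f i))

end Lift

instance : (holimToCone X).Full where
  map_surjective f := ⟨holimHomMk f, holimToCone_map_holimHomMk f⟩

namespace PseudoCone

variable (c : PseudoCone X)

/-- The action on morphisms of the functors on slices associated to a pseudocone. -/
def sliceMap {k j i : I} (σ : k ⟶ j) (τ : j ⟶ i) (ρ : k ⟶ i) (w : σ ≫ τ = ρ) :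
    (act X ρ).obj (c.pt k) ⟶ (act X τ).obj (c.pt j) :=
  eqToHom (by rw [← act_comp_obj, w]) ≫ (act X τ).map (c.tr σ)

theorem sliceMap_id {j i : I} (τ : j ⟶ i) :
    c.sliceMap (𝟙 j) τ τ (Category.id_comp τ) = 𝟙 _ := by
  simp only [sliceMap, c.tr_id, eqToHom_map, eqToHom_trans, eqToHom_refl]

theorem sliceMap_comp {l k j i : I} (σ' : l ⟶ k) (σ : k ⟶ j) (τ : j ⟶ i) (ρ : k ⟶ i)
    (w : σ ≫ τ = ρ) (ρ' : l ⟶ i) (w' : σ' ≫ ρ = ρ') (w'' : (σ' ≫ σ) ≫ τ = ρ') :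
    c.sliceMap (σ' ≫ σ) τ ρ' w'' = c.sliceMap σ' ρ ρ' w' ≫ c.sliceMap σ τ ρ w := by
  subst w w'
  simp only [sliceMap, c.tr_comp, act_comp_map, CategoryTheory.Functor.map_comp, eqToHom_map,
    Category.assoc, eqToHom_trans_assoc, eqToHom_refl, Category.id_comp]

theorem sliceMap_act {k j i i' : I} (σ : k ⟶ j) (τ : j ⟶ i) (ρ : k ⟶ i) (w : σ ≫ τ = ρ)
    (κ : i ⟶ i') (w' : σ ≫ τ ≫ κ = ρ ≫ κ) :
    c.sliceMap σ (τ ≫ κ) (ρ ≫ κ) w' = eqToHom (act_comp_obj X ρ κ _) ≫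
      (act X κ).map (c.sliceMap σ τ ρ w) ≫ eqToHom (act_comp_obj X τ κ _).symm := by
  simp only [sliceMap, act_comp_map, CategoryTheory.Functor.map_comp, eqToHom_map,
    Category.assoc, eqToHom_trans_assoc]

/-- The functors on slices associated to a pseudocone. -/
def slice (i : I) : Over i ⥤ Val X i where
  obj f := (act X f.hom).obj (c.pt f.left)
  map {f f'} g := c.sliceMap g.left f'.hom f.hom (Over.w g)
  map_id f := c.sliceMap_id f.hom
  map_comp {f f' f''} g g' := c.sliceMap_comp g.left g'.left f''.hom f'.hom (Over.w g') f.hom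
    (Over.w g) (Over.w (g ≫ g'))

theorem slice_map {j i : I} (σ : j ⟶ i) :
    Over.map σ ⋙ c.slice i = c.slice j ⋙ act X σ :=
  CategoryTheory.Functor.ext (fun f => act_comp_obj X f.hom σ (c.pt f.left))
    (fun f f' g => c.sliceMap_act g.left f'.hom f.hom (Over.w g) σ
      (Over.w ((Over.map σ).map g)))

/-- The object of the homotopy limit associated to a pseudocone. -/
def toHolim : HoLim X where
  obj i := FreeGroupoid.lift (c.slice i)
  eq := funext fun α =>
    (FreeGroupoid.map_comp_lift (Over.map α.hom) (c.slice α.right)).trans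
      ((congrArg FreeGroupoid.lift (c.slice_map α.hom)).trans
        (FreeGroupoid.lift_comp (c.slice α.left) (act X α.hom)))

theorem sliceMap_eq_tr {j i : I} (σ : j ⟶ i) (w : σ ≫ 𝟙 i = σ) :
    c.sliceMap σ (𝟙 i) σ w ≫ eqToHom (act_id_obj X i (c.pt i)) = c.tr σ := by
  simp only [sliceMap, act_id_map, Category.assoc, eqToHom_trans, eqToHom_trans_assoc,
    eqToHom_refl, Category.id_comp, Category.comp_id]

theorem holimTr_toHolim {j i : I} (σ : j ⟶ i) :
    holimTr c.toHolim σ ≫ eqToHom (act_id_obj X i (c.pt i)) =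
      (act X σ).map (eqToHom (act_id_obj X j (c.pt j))) ≫ c.tr σ := by
  have h : (sliceFunctor c.toHolim i).map (Over.homMk σ : Over.mk σ ⟶ Over.mk (𝟙 i)) =
      c.sliceMap σ (𝟙 i) σ (Category.comp_id σ) :=
    FreeGroupoid.lift_map_homMk (c.slice i) (Over.homMk σ : Over.mk σ ⟶ Over.mk (𝟙 i))
  refine (congrArg (fun z => (eqToHom (sliceFunctor_obj c.toHolim σ).symm ≫ z) ≫
    eqToHom (act_id_obj X i (c.pt i))) h).trans ?_
  refine (Category.assoc _ _ _).trans ?_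
  refine (congrArg (eqToHom _ ≫ ·) (c.sliceMap_eq_tr σ (Category.comp_id σ))).trans ?_
  rw [eqToHom_map]
  rfl

end PseudoCone

instance : (holimToCone X).EssSurj where
  mem_essImage c := by
    let f : (holimToCone X).obj c.toHolim ⟶ c :=
      { app := fun i => eqToHom (act_id_obj X i (c.pt i))
        comm := fun σ => (c.holimTr_toHolim σ).symm }
    have := PseudoCone.isIso_of_hom f
    exact ⟨c.toHolim, ⟨asIso f⟩⟩

instance : (holimToCone X).IsEquivalence where

end PseudoCone

section PseudoConeMap

variable {I : Type u₁} [Category.{v₁} I] {X Y : I ⥤ Grpd.{v, u}} (α : X ⟶ Y)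

/-- The functor between the values at an index of a natural transformation of diagrams of
groupoids. -/
def actApp (i : I) : Val X i ⥤ Val Y i := α.app i

theorem actApp_naturality {j i : I} (σ : j ⟶ i) :
    actApp α j ⋙ act Y σ = act X σ ⋙ actApp α i :=
  (α.naturality σ).symm

theorem actApp_naturality_obj {j i : I} (σ : j ⟶ i) (x : Val X j) :
    (act Y σ).obj ((actApp α j).obj x) = (actApp α i).obj ((act X σ).obj x) :=
  Functor.congr_obj (actApp_naturality α σ) x

theorem actApp_naturality_map {j i : I} (σ : j ⟶ i) {x y : Val X j} (f : x ⟶ y) :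
    (act Y σ).map ((actApp α j).map f) = eqToHom (actApp_naturality_obj α σ x) ≫
      (actApp α i).map ((act X σ).map f) ≫ eqToHom (actApp_naturality_obj α σ y).symm :=
  Functor.congr_hom (actApp_naturality α σ) f

namespace PseudoCone

/-- The image of a pseudocone under a natural transformation of diagrams of groupoids. -/
def mapObj (c : PseudoCone X) : PseudoCone Y where
  pt i := (actApp α i).obj (c.pt i)
  tr {j i} σ := eqToHom (actApp_naturality_obj α σ (c.pt j)) ≫ (actApp α i).map (c.tr σ)
  tr_id i := by simp only [c.tr_id, eqToHom_map, eqToHom_trans]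
  tr_comp σ τ := by
    simp only [c.tr_comp, CategoryTheory.Functor.map_comp, eqToHom_map, actApp_naturality_map,
      Category.assoc, eqToHom_trans_assoc, eqToHom_refl, Category.id_comp]

/-- The functor between pseudocones induced by a natural transformation of diagrams of
groupoids. -/
def map : PseudoCone X ⥤ PseudoCone Y where
  obj := mapObj α
  map {c d} f :=
    { app := fun i => (actApp α i).map (Hom.app f i)
      comm := fun {j i} σ => by
        simp only [mapObj, actApp_naturality_map, Category.assoc, eqToHom_trans_assoc,
          eqToHom_refl, Category.id_comp, ← CategoryTheory.Functor.map_comp]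
        exact congrArg (eqToHom _ ≫ (actApp α i).map ·) (Hom.comm f σ) }
  map_id c := Hom.ext (funext fun i => (actApp α i).map_id (c.pt i))
  map_comp f g := Hom.ext (funext fun i => (actApp α i).map_comp (Hom.app f i) (Hom.app g i))

section

variable [∀ i, (actApp α i).Faithful]

instance : (map α).Faithful where
  map_injective h := Hom.ext (funext fun i =>
    (actApp α i).map_injective (congrFun (congrArg Hom.app h) i))

variable [∀ i, (actApp α i).Full]

instance : (map α).Full where
  map_surjective {c d} f := by
    let g i : c.pt i ⟶ d.pt i := (actApp α i).preimage (Hom.app f i)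
    have hg i : (actApp α i).map (g i) = Hom.app f i := (actApp α i).map_preimage _
    refine ⟨⟨g, fun {j i} σ => (actApp α i).map_injective ?_⟩, Hom.ext (funext hg)⟩
    have h := Hom.comm f σ
    rw [← hg, ← hg] at h
    simp only [map, mapObj, actApp_naturality_map, Category.assoc, eqToHom_trans_assoc,
      eqToHom_refl, Category.id_comp, ← CategoryTheory.Functor.map_comp] at h
    exact (cancel_epi _).1 h

variable {α} in
/-- The pseudocone with given points whose image is identified with a given pseudocone. -/
def lift (d : PseudoCone Y) (pt : ∀ i, Val X i) (e : ∀ i, (actApp α i).obj (pt i) ≅ d.pt i) :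
    PseudoCone X where
  pt := pt
  tr {j i} σ := (actApp α i).preimage (eqToHom (actApp_naturality_obj α σ (pt j)).symm ≫
    (act Y σ).map (e j).hom ≫ d.tr σ ≫ (e i).inv)
  tr_id i := (actApp α i).map_injective (by
    simp only [Functor.map_preimage, d.tr_id, act_id_map, eqToHom_map, Category.assoc,
      eqToHom_trans, eqToHom_trans_assoc, eqToHom_refl, Category.id_comp, Iso.hom_inv_id,
      Category.comp_id])
  tr_comp {k j i} σ τ := (actApp α i).map_injective (by
    have h {x y : Val X j} (f : x ⟶ y) : (actApp α i).map ((act X τ).map f) =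
        eqToHom (actApp_naturality_obj α τ x).symm ≫ (act Y τ).map ((actApp α j).map f) ≫
          eqToHom (actApp_naturality_obj α τ y) := by
      simp [actApp_naturality_map]
    simp only [Functor.map_comp, h, Functor.map_preimage, d.tr_comp, act_comp_map, eqToHom_map,
      Category.assoc, eqToHom_trans_assoc, eqToHom_refl, Category.id_comp]
    simp only [← Functor.map_comp_assoc, Iso.inv_hom_id, Category.comp_id])

variable [∀ i, (actApp α i).EssSurj]

instance : (map α).EssSurj where
  mem_essImage d := by
    let e i := (actApp α i).objObjPreimageIso (d.pt i)
    let f : (map α).obj (lift d _ e) ⟶ d :=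
      { app := fun i => (e i).hom
        comm := fun {j i} σ => by
          simp [map, mapObj, lift] }
    have := isIso_of_hom f
    exact ⟨_, ⟨asIso f⟩⟩

end

instance [∀ i, (actApp α i).IsEquivalence] : (map α).IsEquivalence where

end PseudoCone

end PseudoConeMap

/-! ### The cosimplicial groupoid of simplices of points -/

section Levels

variable {C : Type u} [Category.{v} C] {J : Precoverage C} {X : C}
  (𝒰 : Precoverage.ZeroHypercover.{w} J X)
  {E : Type u₂} [Category.{v₂} E] (p : E ⥤ C)

instance funOverGroupoid [IsFiberedInGroupoids p] {D : Type u₁} [Category.{v₁} D] (π : D ⥤ C) :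
    Groupoid (FunOver π p) :=
  Groupoid.ofIsIso FunOver.isIso_of_hom

/-- The functor `CechLevel.reindex` as a functor over `C`. -/
def CechLevel.reindexOver {m n : ℕ} (σ : Fin (m + 1) → Fin (n + 1)) :
    FunOver (forget 𝒰 n) (forget 𝒰 m) where
  toFunctor := reindex σ
  w := rfl

/-- The cosimplicial groupoid of functors over `C` on the simplices of points of a given
dimension. -/
def levelGroupoid [IsFiberedInGroupoids p] :
    SimplexCategory ⥤ Grpd.{max u v v₂ w, max u v u₂ v₂ w} where
  obj n := Grpd.of (FunOver (CechLevel.forget 𝒰 n.len) p)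
  map σ := FunOver.pre p (CechLevel.reindexOver 𝒰 σ.toOrderHom)
  map_id _ := rfl
  map_comp _ _ := rfl

namespace CechCat

/-- The inclusion of the simplices of points of a given dimension. -/
def incl (n : SimplexCategory) : FunOver (CechLevel.forget 𝒰 n.len) (forget 𝒰) where
  toFunctor :=
    { obj := fun A => ⟨n, A⟩
      map := fun f => ⟨𝟙 n, f⟩
      map_id := fun _ => rfl
      map_comp := fun _ _ => Hom.ext (Category.comp_id (𝟙 n)).symm rfl }
  w := rfl

variable {𝒰}

/-- The morphism to a simplex from its face or degeneracy along a map of simplices. -/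
def face {m n : SimplexCategory} (σ : m ⟶ n) (A : CechLevel 𝒰 n.len) :
    (⟨m, (CechLevel.reindex σ.toOrderHom).obj A⟩ : CechCat 𝒰) ⟶ ⟨n, A⟩ :=
  ⟨σ, 𝟙 _⟩

theorem face_naturality {m n : SimplexCategory} (σ : m ⟶ n) {A B : CechLevel 𝒰 n.len} (f : A ⟶ B) :
    (incl 𝒰 m).fn.map ((CechLevel.reindex σ.toOrderHom).map f) ≫ face σ B =
      face σ A ≫ (incl 𝒰 n).fn.map f :=
  Hom.ext ((Category.id_comp σ).trans (Category.comp_id σ).symm)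
    ((Category.comp_id (CechLevel.Hom.base f)).trans (Category.id_comp _).symm)

theorem face_comp {l m n : SimplexCategory} (σ : l ⟶ m) (τ : m ⟶ n) (A : CechLevel 𝒰 n.len) :
    face (σ ≫ τ) A = face σ ((CechLevel.reindex τ.toOrderHom).obj A) ≫ face τ A :=
  Hom.ext rfl (Category.id_comp (𝟙 A.base)).symm

theorem eq_incl_map_comp_face {A B : CechCat 𝒰} (f : A ⟶ B) :
    f = (incl 𝒰 A.deg).fn.map (Hom.level f) ≫ face (Hom.deg f) B.level :=
  Hom.ext (Category.id_comp (Hom.deg f)).symm (Category.comp_id (Hom.base f)).symm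

end CechCat

variable [IsFiberedInGroupoids p]

variable {𝒰 p} in
/-- The pseudocone formed by the restrictions of a functor over `C` to the simplices of each
dimension. -/
def levelCone (F : FunOver (CechCat.forget 𝒰) p) : PseudoCone (levelGroupoid 𝒰 p) where
  pt n := (FunOver.pre p (CechCat.incl 𝒰 n)).obj F
  tr {m n} σ := FunOver.homMk
    (F := (FunOver.pre p (CechLevel.reindexOver 𝒰 σ.toOrderHom)).obj
      ((FunOver.pre p (CechCat.incl 𝒰 m)).obj F))
    (G := (FunOver.pre p (CechCat.incl 𝒰 n)).obj F)
    (fun A => F.fn.map (CechCat.face σ A))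
    (fun f => (F.fn.map_comp _ _).symm.trans
      ((congrArg F.fn.map (CechCat.face_naturality σ f)).trans (F.fn.map_comp _ _)))
    (fun A => F.isHomLift_map (CechCat.face σ A))
  tr_id n := FunOver.hom_ext fun A => F.fn.map_id _
  tr_comp σ τ := FunOver.hom_ext fun A => by
    refine (congrArg F.fn.map (CechCat.face_comp σ τ A)).trans ((F.fn.map_comp _ _).trans ?_)
    exact (Category.id_comp _).symm

/-- The functor from functors over `C` on the category of simplices of points to pseudocones. -/
def toLevelCone : FunOver (CechCat.forget 𝒰) p ⥤ PseudoCone (levelGroupoid 𝒰 p) where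
  obj := levelCone
  map φ :=
    { app := fun n => (FunOver.pre p (CechCat.incl 𝒰 n)).map φ
      comm := fun σ => FunOver.hom_ext fun A => (FunOver.naturality φ (CechCat.face σ A)).symm }
  map_id _ := rfl
  map_comp _ _ := rfl

instance : (toLevelCone 𝒰 p).Faithful where
  map_injective h := FunOver.hom_ext fun A =>
    congrArg (fun f => FunOver.app (PseudoCone.Hom.app f A.deg) A.level) h

section Lift

variable {𝒰 p} {c : PseudoCone (levelGroupoid 𝒰 p)}

section

variable {F G : FunOver (CechCat.forget 𝒰) p} (f : levelCone F ⟶ levelCone G)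

/-- The components of a morphism of pseudocones, evaluated at the simplices of points. -/
def levelConeHomApp (A : CechCat 𝒰) : F.fn.obj A ⟶ G.fn.obj A :=
  FunOver.app (F := (FunOver.pre p (CechCat.incl 𝒰 A.deg)).obj F)
    (G := (FunOver.pre p (CechCat.incl 𝒰 A.deg)).obj G) (PseudoCone.Hom.app f A.deg) A.level

theorem levelConeHomApp_naturality {A B : CechCat 𝒰} (g : A ⟶ B) :
    F.fn.map g ≫ levelConeHomApp f B = levelConeHomApp f A ≫ G.fn.map g := by
  let A' : CechCat 𝒰 :=
    ⟨A.deg, (CechLevel.reindex (CechCat.Hom.deg g).toOrderHom).obj B.level⟩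
  let i : A ⟶ A' := (CechCat.incl 𝒰 A.deg).fn.map (CechCat.Hom.level g)
  let d : A' ⟶ B := CechCat.face (CechCat.Hom.deg g) B.level
  have hi : F.fn.map i ≫ levelConeHomApp f A' = levelConeHomApp f A ≫ G.fn.map i :=
    FunOver.naturality (F := (FunOver.pre p (CechCat.incl 𝒰 A.deg)).obj F)
      (G := (FunOver.pre p (CechCat.incl 𝒰 A.deg)).obj G) (PseudoCone.Hom.app f A.deg)
      (CechCat.Hom.level g)
  have hd : F.fn.map d ≫ levelConeHomApp f B = levelConeHomApp f A' ≫ G.fn.map d :=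
    (congrArg (fun φ => FunOver.app φ B.level)
      (PseudoCone.Hom.comm f (CechCat.Hom.deg g))).symm
  have hg : g = i ≫ d := CechCat.eq_incl_map_comp_face g
  rw [hg, F.fn.map_comp, G.fn.map_comp, Category.assoc, hd, reassoc_of% hi]

end

variable (c) in
/-- The functor over `C` on the simplices of a given dimension which is part of a pseudocone. -/
def coneLevel (n : SimplexCategory) : FunOver (CechLevel.forget 𝒰 n.len) p := c.pt n

variable (c) in
/-- The transition morphisms of a pseudocone, evaluated at a simplex of points. -/
def coneFace {m n : SimplexCategory} (σ : m ⟶ n) (A : CechLevel 𝒰 n.len) :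
    (coneLevel c m).fn.obj ((CechLevel.reindex σ.toOrderHom).obj A) ⟶ (coneLevel c n).fn.obj A :=
  FunOver.app (F := (FunOver.pre p (CechLevel.reindexOver 𝒰 σ.toOrderHom)).obj (coneLevel c m))
    (G := coneLevel c n) (c.tr σ) A

instance isHomLift_coneFace {m n : SimplexCategory} (σ : m ⟶ n) (A : CechLevel 𝒰 n.len) :
    p.IsHomLift (𝟙 A.base.left) (coneFace c σ A) :=
  FunOver.isHomLift_app
    (F := (FunOver.pre p (CechLevel.reindexOver 𝒰 σ.toOrderHom)).obj (coneLevel c m))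
    (G := coneLevel c n) (c.tr σ) A

theorem coneFace_naturality {m n : SimplexCategory} (σ : m ⟶ n) {A B : CechLevel 𝒰 n.len}
    (f : A ⟶ B) :
    (coneLevel c m).fn.map ((CechLevel.reindex σ.toOrderHom).map f) ≫ coneFace c σ B =
      coneFace c σ A ≫ (coneLevel c n).fn.map f :=
  FunOver.naturality
    (F := (FunOver.pre p (CechLevel.reindexOver 𝒰 σ.toOrderHom)).obj (coneLevel c m))
    (G := coneLevel c n) (c.tr σ) f

theorem coneFace_id {n : SimplexCategory} (A : CechLevel 𝒰 n.len) :
    coneFace c (𝟙 n) A = 𝟙 ((coneLevel c n).fn.obj A) :=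
  congrArg (fun φ => FunOver.app (F := coneLevel c n) (G := coneLevel c n) φ A) (c.tr_id n)

theorem coneFace_comp {l m n : SimplexCategory} (σ : l ⟶ m) (τ : m ⟶ n) (A : CechLevel 𝒰 n.len) :
    coneFace c (σ ≫ τ) A =
      coneFace c σ ((CechLevel.reindex τ.toOrderHom).obj A) ≫ coneFace c τ A :=
  (congrArg (fun φ => FunOver.app
    (F := (FunOver.pre p (CechLevel.reindexOver 𝒰 (σ ≫ τ).toOrderHom)).obj (coneLevel c l))
    (G := coneLevel c n) φ A) (c.tr_comp σ τ)).trans (Category.id_comp _)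

/-- The underlying functor of `coneFunOver`. -/
def coneFunctor (c : PseudoCone (levelGroupoid 𝒰 p)) : CechCat 𝒰 ⥤ E where
  obj A := (coneLevel c A.deg).fn.obj A.level
  map {A B} f := (coneLevel c A.deg).fn.map (CechCat.Hom.level f) ≫
    coneFace c (CechCat.Hom.deg f) B.level
  map_id A := by
    refine (congrArg (_ ≫ ·) (coneFace_id A.level)).trans ((Category.comp_id _).trans ?_)
    exact (coneLevel c A.deg).fn.map_id A.level
  map_comp {A B D} f g := by
    let σ := CechCat.Hom.deg f
    let τ := CechCat.Hom.deg g
    have h₁ := (coneLevel c A.deg).fn.map_comp (CechCat.Hom.level f)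
      ((CechLevel.reindex σ.toOrderHom).map (CechCat.Hom.level g))
    have h₂ := coneFace_naturality (c := c) σ (CechCat.Hom.level g)
    refine (congrArg₂ (· ≫ ·) h₁ (coneFace_comp σ τ D.level)).trans ?_
    simp only [Category.assoc]
    refine congrArg (_ ≫ ·) ((Category.assoc _ _ _).symm.trans ?_)
    exact (congrArg (· ≫ _) h₂).trans (Category.assoc _ _ _)

/-- The functor over `C` on the category of simplices of points given by a pseudocone. -/
def coneFunOver (c : PseudoCone (levelGroupoid 𝒰 p)) : FunOver (CechCat.forget 𝒰) p :=
  FunOver.ofIsHomLift (coneFunctor c) fun {A B} f =>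
    have : p.IsHomLift (CechCat.Hom.base f).left
        ((coneLevel c A.deg).fn.map (CechCat.Hom.level f)) :=
      (coneLevel c A.deg).isHomLift_map (CechCat.Hom.level f)
    isHomLift_comp p (CechCat.Hom.base f).left (𝟙 B.base.left) _ (Category.comp_id _)
      ((coneLevel c A.deg).fn.map (CechCat.Hom.level f)) (coneFace c (CechCat.Hom.deg f) B.level)

end Lift

instance : (toLevelCone 𝒰 p).Full where
  map_surjective {F G} f :=
    ⟨FunOver.homMk (levelConeHomApp f) (levelConeHomApp_naturality f) fun A =>
      FunOver.isHomLift_app (F := (FunOver.pre p (CechCat.incl 𝒰 A.deg)).obj F)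
        (G := (FunOver.pre p (CechCat.incl 𝒰 A.deg)).obj G) (PseudoCone.Hom.app f A.deg) A.level,
      rfl⟩

instance : (toLevelCone 𝒰 p).EssSurj where
  mem_essImage c := by
    let e n : (FunOver.pre p (CechCat.incl 𝒰 n)).obj (coneFunOver c) ⟶ coneLevel c n :=
      FunOver.homMk (fun A => 𝟙 ((coneLevel c n).fn.obj A))
        (fun {A B} f => by
          refine (Category.comp_id _).trans (Eq.trans ?_ (Category.id_comp _).symm)
          exact (congrArg (_ ≫ ·) (coneFace_id B)).trans (Category.comp_id _))
        (fun A => IsHomLift.id ((coneLevel c n).proj_obj A))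
    let f : (toLevelCone 𝒰 p).obj (coneFunOver c) ⟶ c :=
      { app := e
        comm := fun σ => FunOver.hom_ext fun A => by
          refine (Category.id_comp _).trans (Eq.trans ?_ (Category.comp_id _).symm)
          refine Eq.trans ?_ (congrArg (· ≫ _) ((coneLevel c _).fn.map_id _)).symm
          exact (Category.id_comp _).symm }
    have := PseudoCone.isIso_of_hom f
    exact ⟨_, ⟨asIso f⟩⟩

instance : (toLevelCone 𝒰 p).IsEquivalence where

end Levels

/-! ### Functors over a base and equivalences of their sources -/

section PreEquivalence

variable {C : Type u} [Category.{v} C] {E : Type u₂} [Category.{v₂} E] (p : E ⥤ C)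
  {D : Type*} [Category* D] {D' : Type*} [Category* D'] (H : D ⥤ D') (π : D' ⥤ C)

namespace FunOver

/-- Precomposition of functors over `C` with an arbitrary functor `H`, whose source is regarded as
a category over `C` through `H`. -/
def preFunctor : FunOver π p ⥤ FunOver (H ⋙ π) p :=
  pre p
    { toFunctor := H
      w := rfl }

instance [H.EssSurj] : (preFunctor p H π).Faithful where
  map_injective {F G φ ψ} h := hom_ext fun d => by
    have hd : app φ (H.obj (H.objPreimage d)) = app ψ (H.obj (H.objPreimage d)) :=
      congrArg (fun η => app η (H.objPreimage d)) h
    rw [← cancel_epi (F.fn.map (H.objObjPreimageIso d).hom), naturality, naturality, hd]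

section Full

variable {p H π} [H.Full] {F G : FunOver π p}
  (φ : (preFunctor p H π).obj F ⟶ (preFunctor p H π).obj G)

/-- The component at `H.obj d` of a morphism of functors precomposed with `H`. -/
def preApp (d : D) : F.fn.obj (H.obj d) ⟶ G.fn.obj (H.obj d) := app φ d

theorem preApp_naturality {d e : D} (f : H.obj d ⟶ H.obj e) :
    F.fn.map f ≫ preApp φ e = preApp φ d ≫ G.fn.map f := by
  obtain ⟨g, rfl⟩ := H.map_surjective f
  exact naturality φ g

variable [H.EssSurj]

/-- The components of the extension of a morphism along an essentially surjective functor. -/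
def extApp (d : D') : F.fn.obj d ⟶ G.fn.obj d :=
  F.fn.map (H.objObjPreimageIso d).inv ≫ preApp φ (H.objPreimage d) ≫
    G.fn.map (H.objObjPreimageIso d).hom

theorem map_comp_extApp {d : D} {e : D'} (f : H.obj d ⟶ e) :
    F.fn.map f ≫ extApp φ e = preApp φ d ≫ G.fn.map f := by
  rw [extApp, ← F.fn.map_comp_assoc, reassoc_of% preApp_naturality φ, ← G.fn.map_comp,
    Category.assoc, Iso.inv_hom_id, Category.comp_id]

/-- The extension of a morphism along a full and essentially surjective functor. -/
def ext : F ⟶ G :=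
  homMk (extApp φ)
    (fun {d e} f => by
      rw [← cancel_epi (F.fn.map (H.objObjPreimageIso d).hom), ← F.fn.map_comp_assoc,
        map_comp_extApp, reassoc_of% map_comp_extApp φ, G.fn.map_comp])
    (fun d => by
      let e := H.objObjPreimageIso d
      have : p.IsHomLift (𝟙 (π.obj (H.obj (H.objPreimage d)))) (preApp φ (H.objPreimage d)) :=
        isHomLift_app φ _
      exact isHomLift_comp p (π.map e.inv) (π.map e.hom) _
        (by rw [← π.map_comp, e.inv_hom_id, π.map_id]) _ _)

end Full

instance [H.Full] [H.EssSurj] : (preFunctor p H π).Full where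
  map_surjective φ := ⟨ext φ, hom_ext fun d => by
    have h := map_comp_extApp φ (𝟙 (H.obj d))
    rw [CategoryTheory.Functor.map_id, CategoryTheory.Functor.map_id, Category.id_comp,
      Category.comp_id] at h
    exact h⟩

section EssSurj

variable {p π} [IsFiberedInGroupoids p] (e : D ≌ D') (F : FunOver (e.functor ⋙ π) p)

/-- The value at `d` of the extension of `F` along an equivalence: the chosen pullback, to the base
point of `d`, of the value of `F` at the object corresponding to `d`. -/
def extObj (d : D') : E :=
  IsPreFibered.pullbackObj (F.proj_obj (e.inverse.obj d)) (π.map (e.counitInv.app d))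

/-- The projection of the chosen pullback. -/
def extProj (d : D') : extObj e F d ⟶ F.fn.obj (e.inverse.obj d) :=
  IsPreFibered.pullbackMap (F.proj_obj (e.inverse.obj d)) (π.map (e.counitInv.app d))

instance isHomLift_extProj (d : D') :
    p.IsHomLift (π.map (e.counitInv.app d)) (extProj e F d) :=
  (IsPreFibered.pullbackMap.IsCartesian (F.proj_obj (e.inverse.obj d)) _).toIsHomLift

instance isHomLift_extProj_comp {d d' : D'} (f : d ⟶ d') :
    p.IsHomLift (π.map (e.counitInv.app d ≫ e.functor.map (e.inverse.map f)))
      (extProj e F d ≫ F.fn.map (e.inverse.map f)) :=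
  isHomLift_comp p _ ((e.functor ⋙ π).map (e.inverse.map f)) _ (π.map_comp _ _).symm _ _

/-- The action on morphisms of the extension of `F` along an equivalence. -/
def extMap {d d' : D'} (f : d ⟶ d') : extObj e F d ⟶ extObj e F d' :=
  factor p (π.map f) (π.map (e.counitInv.app d'))
    (π.map (e.counitInv.app d ≫ e.functor.map (e.inverse.map f)))
    (by rw [← π.map_comp]; exact congrArg π.map (e.counitInv.naturality f))
    (extProj e F d') (extProj e F d ≫ F.fn.map (e.inverse.map f))

instance isHomLift_extMap {d d' : D'} (f : d ⟶ d') : p.IsHomLift (π.map f) (extMap e F f) :=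
  isHomLift_factor p _ _ _ _ _ _

theorem extMap_proj {d d' : D'} (f : d ⟶ d') :
    extMap e F f ≫ extProj e F d' = extProj e F d ≫ F.fn.map (e.inverse.map f) :=
  factor_comp p _ _ _ _ _ _

/-- The extension of a functor over `C` along an equivalence. -/
def extend : FunOver π p :=
  ofIsHomLift
    { obj := extObj e F
      map := extMap e F
      map_id := fun d => by
        have : p.IsHomLift (π.map (𝟙 d)) (𝟙 (extObj e F d)) := by
          rw [π.map_id]
          exact IsHomLift.id (IsPreFibered.pullbackObj_proj _ _)
        refine eq_of_comp_eq p (π.map (𝟙 d)) (extProj e F d) ?_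
        rw [extMap_proj, e.inverse.map_id, F.fn.map_id, Category.comp_id, Category.id_comp]
      map_comp := fun {d d' d''} f g => by
        have : p.IsHomLift (π.map (f ≫ g)) (extMap e F f ≫ extMap e F g) :=
          isHomLift_comp p (π.map f) (π.map g) _ (π.map_comp f g).symm _ _
        refine eq_of_comp_eq p (π.map (f ≫ g)) (extProj e F d'') ?_
        rw [extMap_proj, Category.assoc, extMap_proj, reassoc_of% extMap_proj e F f,
          e.inverse.map_comp, F.fn.map_comp] }
    (fun f => isHomLift_extMap e F f)

/-- The comparison of `F` with its extension, at the object `d`. -/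
def extendApp (d : D) : extObj e F (e.functor.obj d) ⟶ F.fn.obj d :=
  extProj e F (e.functor.obj d) ≫ F.fn.map (e.unitInv.app d)

theorem extendApp_naturality {d d' : D} (f : d ⟶ d') :
    extMap e F (e.functor.map f) ≫ extendApp e F d' = extendApp e F d ≫ F.fn.map f := by
  rw [extendApp, extendApp, reassoc_of% extMap_proj e F, Category.assoc, ← F.fn.map_comp,
    ← F.fn.map_comp]
  exact congrArg (fun g => extProj e F (e.functor.obj d) ≫ F.fn.map g) (e.unitInv.naturality f)

theorem isHomLift_extendApp (d : D) :
    p.IsHomLift (𝟙 (π.obj (e.functor.obj d))) (extendApp e F d) :=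
  isHomLift_comp p (π.map (e.counitInv.app (e.functor.obj d)))
    ((e.functor ⋙ π).map (e.unitInv.app d)) _
    ((π.map_comp _ _).symm.trans
      ((congrArg π.map (e.counitInv_functor_comp d)).trans (π.map_id _))) _ _

/-- The extension of `F` restricts to `F`. -/
def extendHom : (preFunctor p e.functor π).obj (extend e F) ⟶ F :=
  homMk (F := (preFunctor p e.functor π).obj (extend e F)) (G := F) (extendApp e F)
    (extendApp_naturality e F) (isHomLift_extendApp e F)

end EssSurj

theorem isEquivalence_preFunctor [IsFiberedInGroupoids p] (e : D ≌ D') :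
    (preFunctor p e.functor π).IsEquivalence where
  essSurj.mem_essImage F :=
    have := isIso_of_hom (extendHom e F)
    ⟨extend e F, ⟨asIso (extendHom e F)⟩⟩

instance [IsFiberedInGroupoids p] [H.IsEquivalence] : (preFunctor p H π).IsEquivalence :=
  isEquivalence_preFunctor p π H.asEquivalence

end FunOver

end PreEquivalence

/-! ### Points of the fibre products -/

section PreSigma

variable {C : Type u} [Category.{v} C] {E : Type u₂} [Category.{v₂} E] (p : E ⥤ C)
  {I : Type*} {D : I → Type u₁} [∀ i, Category.{v₁} (D i)] (π : (Σ i, D i) ⥤ C)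

namespace FunOver

/-- The restriction of a functor over `C` on a disjoint union of categories to the members of the
union. -/
def preSigma : FunOver π p ⥤ ∀ i, FunOver (Sigma.incl i ⋙ π) p :=
  Functor.pi' fun i => preFunctor p (Sigma.incl i) π

instance : (preSigma p π).IsEquivalence where
  faithful :=
    { map_injective := fun h => hom_ext fun ⟨i, d⟩ => congrArg (fun η => app (η i) d) h }
  full :=
    { map_surjective := fun {F G} φ =>
        ⟨homMk (F := F) (G := G) (fun d => app (φ d.1) d.2)
          (fun {_ _} f => by obtain ⟨f⟩ := f; exact naturality (φ _) f)
          (fun d => isHomLift_app (φ d.1) d.2), rfl⟩ }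
  essSurj :=
    { mem_essImage := fun F =>
        ⟨ofIsHomLift (Sigma.desc fun i => (F i).fn)
          (fun {_ _} f => by obtain ⟨f⟩ := f; exact (F _).isHomLift_map f), ⟨Iso.refl _⟩⟩ }

end FunOver

end PreSigma

section Member

variable {C : Type u} [Category.{v} C] {J : Precoverage C} {X : C}
  (𝒰 : Precoverage.ZeroHypercover.{w} J X)

variable {𝒰} in
theorem CechLevel.mk_congr {n : ℕ} {V : C} {x : Fin (n + 1) → 𝒰.I₀} {r r' : V ⟶ X}
    {a a' : ∀ k, V ⟶ 𝒰.X (x k)} (hr : r = r') (ha : ∀ k, a k = a' k)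
    (w : ∀ k, a k ≫ 𝒰.f (x k) = r) :
    (⟨Over.mk r, fun k => ⟨x k, a k, w k⟩⟩ : CechLevel 𝒰 n) =
      ⟨Over.mk r', fun k => ⟨x k, a' k, (ha k ▸ w k).trans hr⟩⟩ := by
  obtain rfl := hr
  obtain rfl : a = a' := funext ha
  rfl

instance (n : ℕ) : (CechLevel.forget 𝒰 n).Faithful where
  map_injective h := CechLevel.hom_ext (Over.OverMorphism.ext h)

variable {𝒰} in
/-- An isomorphism of simplices of points from an isomorphism of their sources. -/
def CechLevel.isoMk {n : ℕ} {A B : CechLevel 𝒰 n} (e : A.base ≅ B.base)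
    (h : ∀ k, A.pt k = (B.pt k).comap e.hom) : A ≅ B where
  hom := ⟨e.hom, h⟩
  inv := ⟨e.inv, fun k => by
    rw [h, ← CoverPoint.comap_comp, e.inv_hom_id, CoverPoint.comap_id]⟩
  hom_inv_id := CechLevel.hom_ext e.hom_inv_id
  inv_hom_id := CechLevel.hom_ext e.inv_hom_id

variable [J.HasPullbacks]

/-- A morphism to a fibre product of `n + 1` members of the cover, regarded as an `n`-simplex of
points. -/
def memberPoints {n : ℕ} (x : Fin (n + 1) → 𝒰.I₀) : Over (cechObj 𝒰 x) ⥤ CechLevel 𝒰 n where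
  obj s :=
    { base := Over.mk (s.hom ≫ cechBase 𝒰 x)
      pt := fun k =>
        { idx := x k
          hom := s.hom ≫ WidePullback.π _ k
          w := (Category.assoc _ _ _).trans (congrArg (s.hom ≫ ·) (WidePullback.π_arrow _ k)) } }
  map f :=
    { base := Over.homMk f.left (Over.w_assoc f _)
      pt := fun k => by simp [CoverPoint.comap] }

/-- The simplices of points of dimension `n` as morphisms to the fibre products. -/
def sigmaMemberPoints (n : ℕ) :
    (Σ x : Fin (n + 1) → 𝒰.I₀, Over (cechObj 𝒰 x)) ⥤ CechLevel 𝒰 n :=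
  Sigma.desc (memberPoints 𝒰)

variable {𝒰} {n : ℕ}

theorem exists_memberPoints_map {x y : Fin (n + 1) → 𝒰.I₀} {s : Over (cechObj 𝒰 x)}
    {t : Over (cechObj 𝒰 y)} (f : (memberPoints 𝒰 x).obj s ⟶ (memberPoints 𝒰 y).obj t) :
    ∃ g : (⟨x, s⟩ : Σ x : Fin (n + 1) → 𝒰.I₀, Over (cechObj 𝒰 x)) ⟶ ⟨y, t⟩,
      (sigmaMemberPoints 𝒰 n).map g = f := by
  obtain rfl : x = y := funext fun k => congrArg CoverPoint.idx (CechLevel.Hom.pt f k)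
  let g : s.left ⟶ t.left := (CechLevel.Hom.base f).left
  have hπ (k : Fin (n + 1)) :
      (g ≫ t.hom) ≫ WidePullback.π _ k = s.hom ≫ WidePullback.π _ k := by
    have h := CechLevel.Hom.pt f k
    simp only [memberPoints, CoverPoint.comap, CoverPoint.mk.injEq, heq_eq_eq, true_and] at h
    rw [Category.assoc, h]
  have hbase : (g ≫ t.hom) ≫ cechBase 𝒰 x = s.hom ≫ cechBase 𝒰 x :=
    (Category.assoc _ _ _).trans (Over.w (CechLevel.Hom.base f))
  exact ⟨.mk (Over.homMk g (WidePullback.hom_ext _ _ _ hπ hbase)), rfl⟩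

/-- The morphism to the fibre product determined by a simplex of points. -/
def CechLevel.toMember (A : CechLevel 𝒰 n) : Over (cechObj 𝒰 fun k => (A.pt k).idx) :=
  Over.mk (WidePullback.lift A.base.hom (fun k => (A.pt k).hom) fun k => (A.pt k).w)

theorem CechLevel.toMember_base (A : CechLevel 𝒰 n) :
    A.toMember.hom ≫ cechBase 𝒰 _ = A.base.hom :=
  WidePullback.lift_base _ _ _ _

theorem CechLevel.toMember_proj (A : CechLevel 𝒰 n) (k : Fin (n + 1)) :
    A.toMember.hom ≫ WidePullback.π _ k = (A.pt k).hom :=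
  WidePullback.lift_π _ _ _ _ k

/-- A simplex of points is determined by its morphism to the fibre product. -/
def CechLevel.memberPointsIso (A : CechLevel 𝒰 n) : (memberPoints 𝒰 _).obj A.toMember ≅ A :=
  isoMk (Over.isoMk (Iso.refl _) ((Category.id_comp _).trans A.toMember_base.symm)) fun k => by
    have h : A.toMember.hom ≫ WidePullback.π _ k = 𝟙 _ ≫ (A.pt k).hom :=
      (A.toMember_proj k).trans (Category.id_comp _).symm
    exact (CoverPoint.mk.injEq ..).mpr ⟨rfl, heq_of_eq h⟩

instance : (sigmaMemberPoints 𝒰 n).IsEquivalence where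
  faithful :=
    { map_injective := fun {s t f g} h => by
        obtain ⟨f⟩ := f
        obtain ⟨g⟩ := g
        exact congrArg Sigma.SigmaHom.mk
          (Over.OverMorphism.ext (congrArg (fun h => (CechLevel.Hom.base h).left) h)) }
  full := { map_surjective := exists_memberPoints_map }
  essSurj := { mem_essImage := fun A => ⟨⟨_, A.toMember⟩, ⟨A.memberPointsIso⟩⟩ }

end Member

/-! ### The canonical functor to the homotopy limit -/

section StrictCone

variable {I : Type u₁} [Category.{v₁} I] {X Y : I ⥤ Grpd.{v, u}}

namespace PseudoCone

/-- A pseudocone is strict if its transition morphisms are identities. -/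
def IsStrict (c : PseudoCone X) : Prop :=
  ∀ ⦃j i : I⦄ (σ : j ⟶ i), ∃ h, c.tr σ = eqToHom h

theorem IsStrict.mapObj {c : PseudoCone X} (hc : c.IsStrict) (α : X ⟶ Y) :
    (mapObj α c).IsStrict := fun j i σ => by
  obtain ⟨h, hσ⟩ := hc σ
  refine ⟨(actApp_naturality_obj α σ (c.pt j)).trans (congrArg (actApp α i).obj h), ?_⟩
  simp only [PseudoCone.mapObj, hσ, eqToHom_map, eqToHom_trans]

/-- Strict pseudocones with the same points are isomorphic. -/
def isoOfStrict {c d : PseudoCone X} (hpt : ∀ i, c.pt i = d.pt i) (hc : c.IsStrict)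
    (hd : d.IsStrict) : c ≅ d :=
  let f : c ⟶ d :=
    { app := fun i => eqToHom (hpt i)
      comm := fun σ => by
        obtain ⟨_, hc⟩ := hc σ
        obtain ⟨_, hd⟩ := hd σ
        rw [hc, hd, eqToHom_map, eqToHom_trans, eqToHom_trans] }
  have := isIso_of_hom f
  asIso f

end PseudoCone

end StrictCone

section RestrictCech

variable {C : Type u} [Category.{v} C] {J : Precoverage C} {X : C}
  (𝒰 : Precoverage.ZeroHypercover.{w} J X) {E : Type u₂} [Category.{v₂} E] {p : E ⥤ C}
  [IsFiberedInGroupoids p]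

theorem isStrict_levelCone_restrictCech (F : FunOver (Over.forget X) p) :
    (levelCone ((restrictCech 𝒰 p).obj F)).IsStrict := fun _ _ _ =>
  ⟨rfl, FunOver.hom_ext fun A => F.fn.map_id A.base⟩

end RestrictCech

section Comparison

variable {C : Type u} [Category.{v} C] {J : Precoverage C} [J.HasPullbacks] {X : C}
  (𝒰 : Precoverage.ZeroHypercover.{w} J X) {E : Type u₂} [Category.{v₂} E] (p : E ⥤ C)

/-- The functor `memberPoints` over `C`. -/
def memberPointsOver {n : ℕ} (x : Fin (n + 1) → 𝒰.I₀) :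
    FunOver (Over.forget (cechObj 𝒰 x)) (CechLevel.forget 𝒰 n) where
  toFunctor := memberPoints 𝒰 x
  w := rfl

/-- The restriction of a functor over `C` on the simplices of points of dimension `n` to the fibre
products of `n + 1` members of the cover. -/
def levelToCech (n : ℕ) : FunOver (CechLevel.forget 𝒰 n) p ⥤ CechSections 𝒰 p n :=
  Functor.pi' fun x => FunOver.pre p (memberPointsOver 𝒰 x)

instance [IsFiberedInGroupoids p] (n : ℕ) : (levelToCech 𝒰 p n).IsEquivalence :=
  inferInstanceAs (FunOver.preFunctor p (sigmaMemberPoints 𝒰 n) (CechLevel.forget 𝒰 n) ⋙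
    FunOver.preSigma p (sigmaMemberPoints 𝒰 n ⋙ CechLevel.forget 𝒰 n)).IsEquivalence

theorem cechMap_proj {m n : ℕ} (σ : Fin (m + 1) → Fin (n + 1)) (x : Fin (n + 1) → 𝒰.I₀)
    (k : Fin (m + 1)) :
    cechMap 𝒰 σ x ≫ WidePullback.π (fun k => 𝒰.f (x (σ k))) k = WidePullback.π _ (σ k) :=
  WidePullback.lift_π _ _ _ _ k

theorem memberPoints_reindex_obj {m n : ℕ} (σ : Fin (m + 1) → Fin (n + 1))
    (x : Fin (n + 1) → 𝒰.I₀) (s : Over (cechObj 𝒰 x)) :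
    (CechLevel.reindex σ).obj ((memberPoints 𝒰 x).obj s) =
      (memberPoints 𝒰 (x ∘ σ)).obj ((Over.map (cechMap 𝒰 σ x)).obj s) :=
  CechLevel.mk_congr
    ((congrArg (s.hom ≫ ·) (cechMap_base 𝒰 σ x).symm).trans (Category.assoc _ _ _).symm)
    (fun k => (congrArg (s.hom ≫ ·) (cechMap_proj 𝒰 σ x k).symm).trans
      (Category.assoc _ _ _).symm) _

theorem memberPoints_reindex {m n : ℕ} (σ : Fin (m + 1) → Fin (n + 1)) (x : Fin (n + 1) → 𝒰.I₀) :
    memberPoints 𝒰 x ⋙ CechLevel.reindex σ =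
      Over.map (cechMap 𝒰 σ x) ⋙ memberPoints 𝒰 (x ∘ σ) := by
  refine CategoryTheory.Functor.ext (memberPoints_reindex_obj 𝒰 σ x) fun s t f => ?_
  apply (CechLevel.forget 𝒰 m).map_injective
  rw [CategoryTheory.Functor.map_comp, CategoryTheory.Functor.map_comp, eqToHom_map, eqToHom_map]
  exact ((Category.id_comp _).trans (Category.comp_id f.left)).symm

theorem memberPointsOver_comp {m n : ℕ} (σ : Fin (m + 1) → Fin (n + 1))
    (x : Fin (n + 1) → 𝒰.I₀) :
    (memberPointsOver 𝒰 x).comp (CechLevel.reindexOver 𝒰 σ) =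
      (overMap (cechMap 𝒰 σ x)).comp (memberPointsOver 𝒰 (x ∘ σ)) :=
  basedFunctor_ext (memberPoints_reindex 𝒰 σ x)

theorem levelToCech_naturality {m n : ℕ} (σ : Fin (m + 1) → Fin (n + 1)) :
    FunOver.pre p (CechLevel.reindexOver 𝒰 σ) ⋙ levelToCech 𝒰 p n =
      levelToCech 𝒰 p m ⋙ cechRestrict 𝒰 p σ :=
  congrArg Functor.pi' (funext fun x => congrArg (FunOver.pre p) (memberPointsOver_comp 𝒰 σ x))

variable [IsFiberedInGroupoids p]

/-- The cosimplicial groupoid of a cover as a functor. -/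
def cechDiagram : SimplexCategory ⥤ Grpd.{max u v v₂ w, max u v u₂ v₂ w} := cechGroupoid 𝒰 p

/-- The natural transformation formed by the functors `levelToCech`. -/
def levelToDiagram : levelGroupoid 𝒰 p ⟶ cechDiagram 𝒰 p where
  app n := levelToCech 𝒰 p n.len
  naturality _ _ σ := levelToCech_naturality 𝒰 p σ.toOrderHom

instance (n : SimplexCategory) : (actApp (levelToDiagram 𝒰 p) n).IsEquivalence :=
  inferInstanceAs (levelToCech 𝒰 p n.len).IsEquivalence

/-- The functor from the homotopy limit over a cover to pseudocones. -/
def cechHolimToCone : HoLim (cechGroupoid 𝒰 p) ⥤ PseudoCone (cechDiagram 𝒰 p) :=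
  holimToCone (cechDiagram 𝒰 p)

instance : (cechHolimToCone 𝒰 p).IsEquivalence :=
  inferInstanceAs (holimToCone (cechDiagram 𝒰 p)).IsEquivalence

variable {p}

theorem isStrict_comparison (F : Sections p X) :
    ((cechHolimToCone 𝒰 p).obj ((comparison 𝒰 p).obj F)).IsStrict := fun _ _ _ =>
  ⟨_, Category.comp_id _⟩

variable (p)

/-- Both pseudocones associated to a section over `X` consist of its restrictions to the fibre
products of members of the cover. -/
def comparisonIso :
    restrictCech 𝒰 p ⋙ toLevelCone 𝒰 p ⋙ PseudoCone.map (levelToDiagram 𝒰 p) ≅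
      comparison 𝒰 p ⋙ cechHolimToCone 𝒰 p :=
  NatIso.ofComponents
    (fun F => PseudoCone.isoOfStrict (fun _ => rfl)
      ((isStrict_levelCone_restrictCech 𝒰 F).mapObj (levelToDiagram 𝒰 p))
      (isStrict_comparison 𝒰 F))
    (fun _ => PseudoCone.Hom.ext <| funext fun _ =>
      (Category.comp_id _).trans (Category.id_comp _).symm)

end Comparison

end HomotopySheaf

end

open HomotopySheaf in
theorem theorem1p1_general {C : Type u} [Category.{v} C] {J : Precoverage C} [J.HasPullbacks]
    {X : C} (𝒰 : Precoverage.ZeroHypercover.{w} J X) {E : Type u₂} [Category.{v₂} E] (p : E ⥤ C)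
    [IsFiberedInGroupoids p] :
    SatisfiesDescent p 𝒰 ↔ (comparison 𝒰 p).IsEquivalence := by
  rw [satisfiesDescent_iff_restrictCech]
  have e := comparisonIso 𝒰 p
  constructor <;> intro _
  · have := isEquivalence_of_iso e
    exact isEquivalence_of_comp_right (comparison 𝒰 p) (cechHolimToCone 𝒰 p)
  · have := isEquivalence_of_iso e.symm
    exact isEquivalence_of_comp_right (restrictCech 𝒰 p)
      (toLevelCone 𝒰 p ⋙ PseudoCone.map (levelToDiagram 𝒰 p))

theorem theorem1p1 {C : Type u} [Category.{v} C]
    (J : Precoverage C) [J.HasPullbacks] [J.HasIsos] [J.IsStableUnderBaseChange]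
    [J.IsStableUnderComposition]
    {E : Type u₂} [Category.{v₂} E] (p : E ⥤ C) [HomotopySheaf.IsFiberedInGroupoids p] :
    HomotopySheaf.IsStack.{w} J p ↔
      ∀ (X : C) (𝒰 : Precoverage.ZeroHypercover.{w} J X),
        (HomotopySheaf.comparison 𝒰 p).IsEquivalence :=
  forall₂_congr fun _ 𝒰 => theorem1p1_general 𝒰 p
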